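/- **Conclists and precubical sets.** Fix a finite alphabet $\Sigma$. A *conclist* is a finite set $U$ of events with a strict total order (event order) and a labeling $U\to\Sigma$; conclists are considered up to (unique) isomorphism. A *precubical set* is a set $L$ of cells, a conclist $\mathrm{ev}(x)$ for each $x\in L$, and for $A\subseteq \mathrm{ev}(x)$ faces $\delta^0_A(x),\delta^1_A(x)\in L$ with $\mathrm{ev}(\delta^\nu_A(x))=\mathrm{ev}(x)\setminus A$ and $\delta^\mu_B\delta^\nu_A(x)=\delta^\nu_A\delta^\mu_B(x)$ whenever $A\cap B=\emptyset$. **HDTAs.** Clock constraints over a finite set $C$ of clocks are given by $\phi::=c\bowtie k\mid\phi\wedge\phi$ with $c\in C$, $k\in\mathbb N$, ${\bowtie}\in\{<,\le,\ge,>\}$. A *higher-dimensional timed automaton* (HDTA) $A$ consists of finite $\Sigma$ and $C$, a precubical set on a finite set $L$ of cells, sets $\bot,\top\subseteq L$ of initial and accepting cells, and for each cell $l$ an invariant $\mathrm{inv}(l)$ (a clock constraint) and a set $\mathrm{exit}(l)\subseteq C$. **(Timed) ipomsets.** An *(interval) ipomset* is a finite set $P$ with strict partial orders $<$ (precedence,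 an interval order) and $\dashrightarrow$ (event order) such that distinct events are related by at least one of them, a labeling in $\Sigma$, and subsets $S,T\subseteq P$ (source and target interface) of $<$-minimal and $<$-maximal events. Isomorphisms are bijections respecting $<$, $S$, $T$, labels, and the event order between $<$-incomparable events; ipomsets are taken up to isomorphism. If $T_P\cong S_Q$ as conclists, the *gluing* $P*Q$ is $P\cup Q$ with $T_P$ and $S_Q$ identified; its event order is the transitive closure of ${\dashrightarrow_P}\cup{\dashrightarrow_Q}$; $x<y$ iff $x<_Py$ or $x<_Qy$ or ($x\in P\setminus T_P$ and $y\in Q\setminus S_Q$); its interfaces are $S_P,T_Q$. Otherwise $P*Q$ is undefined. A *starter* (resp. *terminator*) is an ipomset with empty $<$ and $T=P$ (resp. $S=P$). For a conclist $U$ and $A\subseteq U$, $U{\uparrow}A$ is the starter on $U$ with $S=U\setminus A$, $U{\downarrow}A$ is the terminator with $T=U\setminus A$, and $\mathrm{id}_U=U{\uparrow}\emptyset=U{\downarrow}\emptyset$. A *timed ipomset* is an ipomset with $\sigma^-,\sigma^+:P\to\mathbb R_{\ge0}$ and $d\ge0$ such that $\sigma^-\le\sigma^+\le d$, $\sigma^-=0$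 on $S$, $\sigma^+=d$ on $T$, and $\sigma^+(x)<\sigma^-(y)\Rightarrow x<y\Rightarrow\sigma^+(x)\le\sigma^-(y)$. Isomorphisms also preserve $\sigma^\pm$ and $d$. Gluing adds the durations and shifts the times of $Q$ by $d_P$ (a shared event starts at $\sigma_P^-$ and ends at $\sigma^+_Q+d_P$). The *untiming* $\mathrm{unt}$ forgets $\sigma^\pm$ and $d$. **Semantics and language.** States of $A$ are pairs $(l,v)$ with $l\in L$, $v\in\mathbb R_{\ge0}^C$, $v\models\mathrm{inv}(l)$. Moves between states are: (delay) $(l,v)\to(l,v+d)$ with $d\ge0$, if $v+d'\models\mathrm{inv}(l)$ for all $0\le d'\le d$; (start of $U\subseteq\mathrm{ev}(l)$) $(\delta^0_U(l),v)\to(l,v[\mathrm{exit}(\delta^0_U(l))\leftarrow0])$; (termination of $U\subseteq\mathrm{ev}(l)$) $(l,v)\to(\delta^1_U(l),v[\mathrm{exit}(l)\leftarrow0])$. The *content* of a delay $d$ in $l$ is $\mathrm{id}_{\mathrm{ev}(l)}$ with all intervals $[0,d]$ and duration $d$; the contents of a start and of a termination are $\mathrm{ev}(l){\uparrow}U$ and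 $\mathrm{ev}(l){\downarrow}U$ with all intervals $[0,0]$ and duration $0$. The content of a path (a finite sequence of consecutive moves) is the gluing of the contents of its moves; for the path without moves at $(l,v)$ it is $\mathrm{id}_{\mathrm{ev}(l)}$ with duration $0$. $\mathcal L(A)$ is the set of contents of paths from a state $(l,v^0)$ with $l\in\bot$ and $v^0=0$ to a state $(l',v)$ with $l'\in\top$. **Region automaton.** Let $M$ be the largest constant in the invariants of $A$ ($0$ if there are none). Valuations $v,v'$ are *region equivalent* if for all clocks $x,y$: $\lfloor v(x)\rfloor=\lfloor v'(x)\rfloor$ or $v(x),v'(x)>M$; $v(x)$ is an integer iff $v'(x)$ is; and the fractional parts satisfy $\langle v(x)\rangle\le\langle v(y)\rangle$ iff $\langle v'(x)\rangle\le\langle v'(y)\rangle$. Regions are the equivalence classes. The region automaton $R(A)$ is the automaton over the alphabet $\mathrm{St}\cup\mathrm{Te}$ of starters and terminators whose states are the pairs $(l,r)$ of a cell and a region with $v\models\mathrm{inv}(l)$ for all $v\in r$, and an additional state $l_\bot$ for each $l\in\bot$; the $l_\bot$ are the initial states, and the $(l,r)$ with $l\in\top$ are the accepting ones. Its transitions are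 $l_\bot\to(l,[v^0])$ labeled $\mathrm{id}_{\mathrm{ev}(l)}$ (if $(l,[v^0])$ is a state), and $(l,[v])\to(l',[v'])$ for each move $(l,v)\to(l',v')$ of $A$, labeled $\mathrm{id}_{\mathrm{ev}(l)}$ for a delay, $\mathrm{ev}(l'){\uparrow}U$ for a start of $U$, and $\mathrm{ev}(l){\downarrow}U$ for a termination of $U$. **Theorem.** For every HDTA $A$, the region automaton $R(A)$ has finitely many states; every word $P_1\cdots P_n$ that it accepts is coherent, that is, $n\ge1$ and the gluing $P_1*\cdots*P_n$ is defined (and unique up to isomorphism); and $$\{P_1*\cdots*P_n \mid P_1\cdots P_n \text{ accepted by } R(A)\}=\mathrm{unt}(\mathcal L(A))=\{\mathrm{unt}(P)\mid P\in\mathcal L(A)\}.$$ -/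

import Mathlib

open scoped NNReal

universe u v w

/-! ### Concurrency lists -/

/-- A conclist over `α`: a finite set of events with a strict total event order and a labeling. -/
structure Conclist (α : Type u) where
  carrier : Type
  finite : Finite carrier
  evord : carrier → carrier → Prop
  evord_irrefl : ∀ x, ¬ evord x x
  evord_trans : ∀ x y z, evord x y → evord y z → evord x z
  evord_total : ∀ x y, x ≠ y → evord x y ∨ evord y x
  label : carrier → α

namespace Conclist

variable {α : Type u}

/-- Isomorphisms of conclists (there is at most one between two given conclists). -/
structure Iso (U V : Conclist α) extends U.carrier ≃ V.carrier where
  map_evord : ∀ x y, V.evord (toFun x) (toFun y) ↔ U.evord x y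
  map_label : ∀ x, V.label (toFun x) = U.label x

def Iso.refl (U : Conclist α) : Iso U U where
  toEquiv := Equiv.refl _
  map_evord _ _ := Iff.rfl
  map_label _ := rfl

def Iso.ofEq {U V : Conclist α} (h : U = V) : Iso U V := h ▸ Iso.refl U

def Iso.symm {U V : Conclist α} (f : Iso U V) : Iso V U where
  toEquiv := f.toEquiv.symm
  map_evord x y := by
    have := f.map_evord (f.toEquiv.symm x) (f.toEquiv.symm y)
    simpa using this.symm
  map_label x := by
    have := f.map_label (f.toEquiv.symm x)
    simpa using this.symm

def Iso.trans {U V W : Conclist α} (f : Iso U V) (g : Iso V W) : Iso U W where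
  toEquiv := f.toEquiv.trans g.toEquiv
  map_evord _ _ := (g.map_evord _ _).trans (f.map_evord _ _)
  map_label _ := (g.map_label _).trans (f.map_label _)

/-- The restriction of a conclist to a subset of its events. -/
def restrict (U : Conclist α) (B : Set U.carrier) : Conclist α where
  carrier := B
  finite := have := U.finite; inferInstance
  evord x y := U.evord x y
  evord_irrefl x := U.evord_irrefl x
  evord_trans x y z := U.evord_trans x y z
  evord_total x y h := U.evord_total x y (fun e => h (Subtype.ext e))
  label x := U.label x

def restrictUniv (U : Conclist α) : Iso (U.restrict Set.univ) U where
  toEquiv := Equiv.Set.univ _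
  map_evord _ _ := Iff.rfl
  map_label _ := rfl

/-- The conclist `U ∖ A`. -/
def remove (U : Conclist α) (A : Set U.carrier) : Conclist α := U.restrict Aᶜ

end Conclist

/-! ### Pomsets with interfaces -/

/-- An interval pomset with interfaces: precedence `prec`, event order `evord`, source interface,
target interface and labeling, such that the precedence is an interval order. -/
structure Ipomset (α : Type u) where
  carrier : Type
  finite : Finite carrier
  prec : carrier → carrier → Prop
  evord : carrier → carrier → Prop
  source : Set carrier
  target : Set carrier
  label : carrier → α
  prec_irrefl : ∀ x, ¬ prec x x
  prec_trans : ∀ x y z, prec x y → prec y z → prec x z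
  evord_irrefl : ∀ x, ¬ evord x x
  evord_trans : ∀ x y z, evord x y → evord y z → evord x z
  comparable : ∀ x y, x ≠ y → prec x y ∨ prec y x ∨ evord x y ∨ evord y x
  source_minimal : ∀ x ∈ source, ∀ y, ¬ prec y x
  target_maximal : ∀ x ∈ target, ∀ y, ¬ prec x y
  interval : ∃ lo hi : carrier → ℝ, (∀ x, lo x ≤ hi x) ∧ ∀ x y, prec x y ↔ hi x < lo y

namespace Ipomset

variable {α : Type u}

/-- A bijection `f : P → Q` is an isomorphism if it respects interfaces, labels, the precedence
order, and the event order between concurrent events. -/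
structure IsIso (P Q : Ipomset α) (f : P.carrier ≃ Q.carrier) : Prop where
  source : ∀ x, f x ∈ Q.source ↔ x ∈ P.source
  target : ∀ x, f x ∈ Q.target ↔ x ∈ P.target
  label : ∀ x, Q.label (f x) = P.label x
  prec : ∀ x y, Q.prec (f x) (f y) ↔ P.prec x y
  evord : ∀ x y, ¬ P.prec x y → ¬ P.prec y x → (P.evord x y ↔ Q.evord (f x) (f y))

theorem IsIso.refl (P : Ipomset α) : IsIso P P (Equiv.refl _) :=
  ⟨fun _ => Iff.rfl, fun _ => Iff.rfl, fun _ => rfl, fun _ _ => Iff.rfl, fun _ _ _ _ => Iff.rfl⟩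

theorem IsIso.symm {P Q : Ipomset α} {f : P.carrier ≃ Q.carrier} (h : IsIso P Q f) :
    IsIso Q P f.symm where
  source x := by simpa using (h.source (f.symm x)).symm
  target x := by simpa using (h.target (f.symm x)).symm
  label x := by simpa using (h.label (f.symm x)).symm
  prec x y := by simpa using (h.prec (f.symm x) (f.symm y)).symm
  evord x y h1 h2 := by
    have e1 := h.prec (f.symm x) (f.symm y)
    have e2 := h.prec (f.symm y) (f.symm x)
    have := h.evord (f.symm x) (f.symm y)
    simp only [Equiv.apply_symm_apply] at e1 e2 this
    exact (this (fun k => h1 (e1.2 k)) (fun k => h2 (e2.2 k))).symm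

theorem IsIso.trans {P Q R : Ipomset α} {f : P.carrier ≃ Q.carrier} {g : Q.carrier ≃ R.carrier}
    (h : IsIso P Q f) (k : IsIso Q R g) : IsIso P R (f.trans g) where
  source x := (k.source _).trans (h.source x)
  target x := (k.target _).trans (h.target x)
  label x := (k.label _).trans (h.label x)
  prec x y := (k.prec _ _).trans (h.prec x y)
  evord x y h1 h2 := (h.evord x y h1 h2).trans
    (k.evord _ _ (fun e => h1 ((h.prec _ _).1 e)) (fun e => h2 ((h.prec _ _).1 e)))

instance setoid (α : Type u) : Setoid (Ipomset α) where
  r P Q := ∃ f, IsIso P Q f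
  iseqv := ⟨fun P => ⟨_, IsIso.refl P⟩, fun ⟨_, h⟩ => ⟨_, h.symm⟩, fun ⟨_, h⟩ ⟨_, k⟩ => ⟨_, h.trans k⟩⟩

/-- The source interface, as a conclist. -/
def sourceConclist (P : Ipomset α) : Conclist α where
  carrier := P.source
  finite := have := P.finite; inferInstance
  evord x y := P.evord x y
  evord_irrefl x := P.evord_irrefl x
  evord_trans x y z := P.evord_trans x y z
  evord_total x y h := by
    have h1 := P.source_minimal x x.2 y
    have h2 := P.source_minimal y y.2 x
    have h3 := P.comparable x y (fun e => h (Subtype.ext e))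
    tauto
  label x := P.label x

/-- The target interface, as a conclist. -/
def targetConclist (P : Ipomset α) : Conclist α where
  carrier := P.target
  finite := have := P.finite; inferInstance
  evord x y := P.evord x y
  evord_irrefl x := P.evord_irrefl x
  evord_trans x y z := P.evord_trans x y z
  evord_total x y h := by
    have h1 := P.target_maximal x x.2 y
    have h2 := P.target_maximal y y.2 x
    have h3 := P.comparable x y (fun e => h (Subtype.ext e))
    tauto
  label x := P.label x

/-- Discrete ipomsets: empty precedence. -/
def IsDiscrete (P : Ipomset α) : Prop := ∀ x y, ¬ P.prec x y

/-- Starters: discrete ipomsets all of whose events are in the target interface. -/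
def IsStarter (P : Ipomset α) : Prop := P.IsDiscrete ∧ P.target = Set.univ

/-- Terminators: discrete ipomsets all of whose events are in the source interface. -/
def IsTerminator (P : Ipomset α) : Prop := P.IsDiscrete ∧ P.source = Set.univ

/-- The discrete ipomset on the conclist `U` with interfaces `S` and `T`. -/
def discrete (U : Conclist α) (S T : Set U.carrier) : Ipomset α where
  carrier := U.carrier
  finite := U.finite
  prec _ _ := False
  evord := U.evord
  source := S
  target := T
  label := U.label
  prec_irrefl _ h := h
  prec_trans _ _ _ h _ := h
  evord_irrefl := U.evord_irrefl
  evord_trans := U.evord_trans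
  comparable x y h := Or.inr (Or.inr (U.evord_total x y h))
  source_minimal _ _ _ h := h
  target_maximal _ _ _ h := h
  interval := ⟨fun _ => 0, fun _ => 0, by simp, by simp⟩

/-- The identity `id_U`. -/
def identity (U : Conclist α) : Ipomset α := discrete U Set.univ Set.univ

/-- The starter `U↑A`, which starts the events in `A`. -/
def starter (U : Conclist α) (A : Set U.carrier) : Ipomset α := discrete U Aᶜ Set.univ

/-- The terminator `U↓B`, which terminates the events in `B`. -/
def terminator (U : Conclist α) (B : Set U.carrier) : Ipomset α := discrete U Set.univ Bᶜ

/-! #### Gluing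

For `f` the isomorphism of conclists between `T_P` and `S_Q`, the gluing lives on `P ∪ Q` with
`T_P` and `S_Q` identified along `f`, that is, on the disjoint union of `P` and `Q ∖ S_Q`. -/

/-- Events of the gluing. -/
abbrev GlueCarrier (P Q : Ipomset α) : Type := P.carrier ⊕ {y : Q.carrier // y ∉ Q.source}

section Glue

variable (P Q : Ipomset α) (f : P.targetConclist.Iso Q.sourceConclist)

/-- `P` as a part of the gluing. -/
def inP (x : P.carrier) : GlueCarrier P Q := Sum.inl x

open Classical in
/-- `Q` as a part of the gluing. -/
noncomputable def inQ (y : Q.carrier) : GlueCarrier P Q :=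
  if h : y ∈ Q.source then Sum.inl (f.toEquiv.symm ⟨y, h⟩ : P.target).1 else Sum.inr ⟨y, h⟩

/-- Precedence of the gluing. -/
def gluePrec (a b : GlueCarrier P Q) : Prop :=
  (∃ x y, a = inP P Q x ∧ b = inP P Q y ∧ P.prec x y) ∨
  (∃ x y, a = inQ P Q f x ∧ b = inQ P Q f y ∧ Q.prec x y) ∨
  (∃ x y, a = inP P Q x ∧ b = inQ P Q f y ∧ x ∉ P.target ∧ y ∉ Q.source)

/-- The union of the event orders of `P` and `Q`. -/
def glueEvordStep (a b : GlueCarrier P Q) : Prop :=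
  (∃ x y, a = inP P Q x ∧ b = inP P Q y ∧ P.evord x y) ∨
  (∃ x y, a = inQ P Q f x ∧ b = inQ P Q f y ∧ Q.evord x y)

variable {P Q}

theorem inQ_of_mem {y : Q.carrier} (h : y ∈ Q.source) :
    inQ P Q f y = Sum.inl (f.toEquiv.symm ⟨y, h⟩ : P.target).1 := dif_pos h

theorem inQ_of_notMem {y : Q.carrier} (h : y ∉ Q.source) :
    inQ P Q f y = Sum.inr ⟨y, h⟩ := dif_neg h

theorem inl_eq_inQ {x : P.carrier} {y : Q.carrier} :
    (Sum.inl x : GlueCarrier P Q) = inQ P Q f y ↔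
      ∃ h : x ∈ P.target, (f.toEquiv ⟨x, h⟩ : Q.source).1 = y := by
  by_cases hy : y ∈ Q.source
  · rw [inQ_of_mem f hy, Sum.inl.injEq]
    constructor
    · intro e
      refine ⟨e ▸ (f.toEquiv.symm ⟨y, hy⟩ : P.target).2, ?_⟩
      have : (⟨x, e ▸ (f.toEquiv.symm ⟨y, hy⟩ : P.target).2⟩ : P.target)
          = f.toEquiv.symm ⟨y, hy⟩ := Subtype.ext e
      rw [this]
      exact congrArg Subtype.val (f.toEquiv.apply_symm_apply ⟨y, hy⟩)
    · rintro ⟨h, e⟩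
      have : (⟨y, hy⟩ : Q.source) = f.toEquiv ⟨x, h⟩ := Subtype.ext e.symm
      rw [this]
      exact (congrArg Subtype.val (f.toEquiv.symm_apply_apply ⟨x, h⟩)).symm
  · rw [inQ_of_notMem f hy]
    constructor
    · intro e; cases e
    · rintro ⟨h, e⟩
      exact absurd (e ▸ (f.toEquiv ⟨x, h⟩ : Q.source).2) hy

theorem inr_eq_inQ {z : {y : Q.carrier // y ∉ Q.source}} {y : Q.carrier} :
    (Sum.inr z : GlueCarrier P Q) = inQ P Q f y ↔ z.1 = y := by
  by_cases hy : y ∈ Q.source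
  · rw [inQ_of_mem f hy]
    constructor
    · intro e; cases e
    · intro e; exact absurd (e ▸ hy) z.2
  · rw [inQ_of_notMem f hy, Sum.inr.injEq, Subtype.ext_iff]

theorem inQ_injective : Function.Injective (inQ P Q f) := by
  intro y y' e
  rcases hy : inQ P Q f y with x | z
  · obtain ⟨_, h1⟩ := (inl_eq_inQ f).1 hy.symm
    obtain ⟨_, h2⟩ := (inl_eq_inQ f).1 (hy.symm.trans e)
    exact h1.symm.trans h2
  · exact ((inr_eq_inQ f).1 hy.symm).symm.trans ((inr_eq_inQ f).1 (hy.symm.trans e))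

theorem gluePrec_inl_inl {x y : P.carrier} :
    gluePrec P Q f (Sum.inl x) (Sum.inl y) ↔ P.prec x y := by
  constructor
  · rintro (⟨a, b, h1, h2, h⟩ | ⟨a, b, h1, h2, h⟩ | ⟨a, b, h1, h2, h, h'⟩)
    · cases h1; cases h2; exact h
    · obtain ⟨hy, e⟩ := (inl_eq_inQ f).1 h2
      exact absurd h (Q.source_minimal b (e ▸ (f.toEquiv ⟨y, hy⟩ : Q.source).2) a)
    · obtain ⟨hy, e⟩ := (inl_eq_inQ f).1 h2
      exact absurd (e ▸ (f.toEquiv ⟨y, hy⟩ : Q.source).2) h'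
  · intro h; exact Or.inl ⟨x, y, rfl, rfl, h⟩

theorem gluePrec_inl_inr {x : P.carrier} {y : {y : Q.carrier // y ∉ Q.source}} :
    gluePrec P Q f (Sum.inl x) (Sum.inr y) ↔
      ∀ h : x ∈ P.target, Q.prec (f.toEquiv ⟨x, h⟩ : Q.source).1 y.1 := by
  constructor
  · rintro (⟨a, b, h1, h2, h⟩ | ⟨a, b, h1, h2, h⟩ | ⟨a, b, h1, h2, h, h'⟩) hx
    · cases h2
    · obtain ⟨_, rfl⟩ := (inl_eq_inQ f).1 h1
      obtain rfl := (inr_eq_inQ f).1 h2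
      exact h
    · cases h1; exact absurd hx h
  · intro h
    by_cases hx : x ∈ P.target
    · exact Or.inr (Or.inl ⟨_, y.1, (inl_eq_inQ f).2 ⟨hx, rfl⟩, (inr_eq_inQ f).2 rfl, h hx⟩)
    · exact Or.inr (Or.inr ⟨x, y.1, rfl, (inr_eq_inQ f).2 rfl, hx, y.2⟩)

theorem gluePrec_inr_inl {y : {y : Q.carrier // y ∉ Q.source}} {x : P.carrier} :
    ¬ gluePrec P Q f (Sum.inr y) (Sum.inl x) := by
  rintro (⟨a, b, h1, h2, h⟩ | ⟨a, b, h1, h2, h⟩ | ⟨a, b, h1, h2, h, h'⟩)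
  · cases h1
  · obtain ⟨hx, e⟩ := (inl_eq_inQ f).1 h2
    exact absurd h (Q.source_minimal b (e ▸ (f.toEquiv ⟨x, hx⟩ : Q.source).2) a)
  · cases h1

theorem gluePrec_inr_inr {y z : {y : Q.carrier // y ∉ Q.source}} :
    gluePrec P Q f (Sum.inr y) (Sum.inr z) ↔ Q.prec y.1 z.1 := by
  constructor
  · rintro (⟨a, b, h1, h2, h⟩ | ⟨a, b, h1, h2, h⟩ | ⟨a, b, h1, h2, h, h'⟩)
    · cases h1
    · obtain rfl := (inr_eq_inQ f).1 h1
      obtain rfl := (inr_eq_inQ f).1 h2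
      exact h
    · cases h1
  · intro h
    exact Or.inr (Or.inl ⟨y.1, z.1, (inr_eq_inQ f).2 rfl, (inr_eq_inQ f).2 rfl, h⟩)

/-- On events of both `P` and `Q`, the two event orders agree. -/
theorem evord_shared {x x' : P.carrier} {y y' : Q.carrier}
    (h : (Sum.inl x : GlueCarrier P Q) = inQ P Q f y)
    (h' : (Sum.inl x' : GlueCarrier P Q) = inQ P Q f y') : Q.evord y y' ↔ P.evord x x' := by
  obtain ⟨hx, rfl⟩ := (inl_eq_inQ f).1 h
  obtain ⟨hx', rfl⟩ := (inl_eq_inQ f).1 h'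
  exact f.map_evord ⟨x, hx⟩ ⟨x', hx'⟩

/-- What a chain of event-order steps says about its two ends. -/
theorem evord_of_transGen {a b : GlueCarrier P Q}
    (h : Relation.TransGen (glueEvordStep P Q f) a b) :
    (∀ x x', a = inP P Q x → b = inP P Q x' → P.evord x x') ∧
    (∀ y y', a = inQ P Q f y → b = inQ P Q f y' → Q.evord y y') ∧
    (∀ x y, a = inP P Q x → b = inQ P Q f y → y ∉ Q.source →
      ∃ x₀ y₀, inP P Q x₀ = inQ P Q f y₀ ∧ (x = x₀ ∨ P.evord x x₀) ∧ Q.evord y₀ y) ∧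
    (∀ y x, a = inQ P Q f y → b = inP P Q x → y ∉ Q.source →
      ∃ x₀ y₀, inP P Q x₀ = inQ P Q f y₀ ∧ Q.evord y y₀ ∧ (x₀ = x ∨ P.evord x₀ x)) := by
  have key : ∀ {x : P.carrier} {y : Q.carrier}, inP P Q x = inQ P Q f y → y ∈ Q.source := by
    intro x y e
    obtain ⟨hx, e⟩ := (inl_eq_inQ f).1 e
    exact e ▸ (f.toEquiv ⟨x, hx⟩ : Q.source).2
  have inPi : ∀ {x x' : P.carrier}, inP P Q x = inP P Q x' → x = x' := fun e => Sum.inl.inj e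
  have inQi : ∀ {y y' : Q.carrier}, inQ P Q f y = inQ P Q f y' → y = y' :=
    fun e => inQ_injective f e
  have sh : ∀ {x x' : P.carrier} {y y' : Q.carrier}, inP P Q x = inQ P Q f y →
      inP P Q x' = inQ P Q f y' → (Q.evord y y' ↔ P.evord x x') := fun h h' => evord_shared f h h'
  have single : ∀ {a b : GlueCarrier P Q}, glueEvordStep P Q f a b →
      (∀ x x', a = inP P Q x → b = inP P Q x' → P.evord x x') ∧
      (∀ y y', a = inQ P Q f y → b = inQ P Q f y' → Q.evord y y') ∧
      (∀ x y, a = inP P Q x → b = inQ P Q f y → y ∉ Q.source →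
        ∃ x₀ y₀, inP P Q x₀ = inQ P Q f y₀ ∧ (x = x₀ ∨ P.evord x x₀) ∧ Q.evord y₀ y) ∧
      (∀ y x, a = inQ P Q f y → b = inP P Q x → y ∉ Q.source →
        ∃ x₀ y₀, inP P Q x₀ = inQ P Q f y₀ ∧ Q.evord y y₀ ∧ (x₀ = x ∨ P.evord x₀ x)) := by
    rintro a b (⟨p, q, rfl, rfl, h⟩ | ⟨p, q, rfl, rfl, h⟩)
    · refine ⟨fun x x' e e' => inPi e ▸ inPi e' ▸ h, fun y y' e e' => (sh e e').2 h,
        fun x y _ e' hy => absurd (key e') hy, fun y x e _ hy => absurd (key e) hy⟩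
    · refine ⟨fun x x' e e' => (sh e.symm e'.symm).1 h, fun y y' e e' => inQi e ▸ inQi e' ▸ h,
        fun x y e e' _ => ⟨x, p, e.symm, Or.inl rfl, inQi e' ▸ h⟩,
        fun y x e e' _ => ⟨x, q, e'.symm, inQi e ▸ h, Or.inl rfl⟩⟩
  have cover : ∀ c : GlueCarrier P Q, (∃ x, c = inP P Q x) ∨ ∃ y, c = inQ P Q f y ∧ y ∉ Q.source := by
    rintro (x | y)
    · exact Or.inl ⟨x, rfl⟩
    · exact Or.inr ⟨y.1, (inr_eq_inQ f).2 rfl, y.2⟩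
  -- an event outside the interface cannot be reached from `P` to a shared event except through
  -- a shared event, on which both orders agree
  induction h with
  | single h => exact single h
  | @tail b c _ h ih =>
    obtain ⟨i1, i2, i3, i4⟩ := ih
    obtain ⟨s1, s2, s3, s4⟩ := single h
    rcases cover b with ⟨m, hm⟩ | ⟨m, hm, hmS⟩
    · refine ⟨fun x x' e e' => P.evord_trans _ _ _ (i1 x m e hm) (s1 m x' hm e'), ?_, ?_, ?_⟩
      · intro y y' e e'
        rcases cover a with ⟨x, hx⟩ | ⟨y₁, hy₁, hyS⟩
        · have hxm := i1 x m hx hm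
          by_cases hy' : y' ∈ Q.source
          · have e'' : inP P Q (f.toEquiv.symm ⟨y', hy'⟩ : P.target).1 = inQ P Q f y' :=
              (inQ_of_mem f hy').symm
            exact (sh (hx ▸ e) e'').2
              (P.evord_trans _ _ _ hxm (s1 m _ hm (e'.trans e''.symm)))
          · obtain ⟨x₀, y₀, h0, h1, h2⟩ := s3 m y' hm e' hy'
            refine Q.evord_trans _ y₀ _ ((sh (hx ▸ e) h0).2 ?_) h2
            rcases h1 with rfl | h1
            · exact hxm
            · exact P.evord_trans _ _ _ hxm h1
        · obtain rfl : y = y₁ := inQi (e.symm.trans hy₁)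
          obtain ⟨x₀, y₀, h0, h1, h2⟩ := i4 y m e hm hyS
          have hx₀ : ∀ {z}, P.evord m z → P.evord x₀ z := by
            intro z hz
            rcases h2 with rfl | h2
            · exact hz
            · exact P.evord_trans _ _ _ h2 hz
          refine Q.evord_trans _ y₀ _ h1 ?_
          by_cases hy' : y' ∈ Q.source
          · have e'' : inP P Q (f.toEquiv.symm ⟨y', hy'⟩ : P.target).1 = inQ P Q f y' :=
              (inQ_of_mem f hy').symm
            exact (sh h0 e'').2 (hx₀ (s1 m _ hm (e'.trans e''.symm)))
          · obtain ⟨x₁, y₁, k0, k1, k2⟩ := s3 m y' hm e' hy'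
            have : x₀ = x₁ ∨ P.evord x₀ x₁ := by
              rcases k1 with rfl | k1
              · exact h2
              · exact Or.inr (hx₀ k1)
            rcases this with rfl | this
            · obtain rfl : y₀ = y₁ := inQi (h0.symm.trans k0)
              exact k2
            · exact Q.evord_trans _ _ _ ((sh h0 k0).2 this) k2
      · intro x y e e' hy
        obtain ⟨x₀, y₀, h0, h1, h2⟩ := s3 m y hm e' hy
        refine ⟨x₀, y₀, h0, Or.inr ?_, h2⟩
        rcases h1 with rfl | h1
        · exact i1 _ _ e hm
        · exact P.evord_trans _ _ _ (i1 _ _ e hm) h1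
      · intro y x e e' hy
        obtain ⟨x₀, y₀, h0, h1, h2⟩ := i4 y m e hm hy
        refine ⟨x₀, y₀, h0, h1, Or.inr ?_⟩
        rcases h2 with rfl | h2
        · exact s1 _ _ hm e'
        · exact P.evord_trans _ _ _ h2 (s1 _ _ hm e')
    · refine ⟨?_, fun y y' e e' => Q.evord_trans _ _ _ (i2 y m e hm) (s2 m y' hm e'), ?_, ?_⟩
      · intro x x' e e'
        obtain ⟨x₀, y₀, h0, h1, h2⟩ := i3 x m e hm hmS
        obtain ⟨x₁, y₁, k0, k1, k2⟩ := s4 m x' hm e' hmS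
        have h3 := (sh h0 k0).1 (Q.evord_trans _ _ _ h2 k1)
        have h4 : P.evord x x₁ := by
          rcases h1 with rfl | h1
          · exact h3
          · exact P.evord_trans _ _ _ h1 h3
        rcases k2 with rfl | k2
        · exact h4
        · exact P.evord_trans _ _ _ h4 k2
      · intro x y e e' hy
        obtain ⟨x₀, y₀, h0, h1, h2⟩ := i3 x m e hm hmS
        exact ⟨x₀, y₀, h0, h1, Q.evord_trans _ _ _ h2 (s2 _ _ hm e')⟩
      · intro y x e e' hy
        obtain ⟨x₀, y₀, h0, h1, h2⟩ := s4 m x hm e' hmS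
        exact ⟨x₀, y₀, h0, Q.evord_trans _ _ _ (i2 _ _ e hm) h1, h2⟩

theorem evord_inP_iff {x x' : P.carrier} :
    Relation.TransGen (glueEvordStep P Q f) (inP P Q x) (inP P Q x') ↔ P.evord x x' :=
  ⟨fun h => (evord_of_transGen f h).1 _ _ rfl rfl,
    fun h => Relation.TransGen.single (Or.inl ⟨_, _, rfl, rfl, h⟩)⟩

theorem evord_inQ_iff {y y' : Q.carrier} :
    Relation.TransGen (glueEvordStep P Q f) (inQ P Q f y) (inQ P Q f y') ↔ Q.evord y y' :=
  ⟨fun h => (evord_of_transGen f h).2.1 _ _ rfl rfl,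
    fun h => Relation.TransGen.single (Or.inr ⟨_, _, rfl, rfl, h⟩)⟩

open Classical in
/-- The right end of an event of the gluing, if `Q` starts at time `c`. -/
noncomputable def glueHi {K : Type*} [Add K] (p : P.carrier → K) (q : Q.carrier → K) (c : K) :
    GlueCarrier P Q → K
  | Sum.inl x => if h : x ∈ P.target then q (f.toEquiv ⟨x, h⟩ : Q.source).1 + c else p x
  | Sum.inr y => q y.1 + c

/-- The left end of an event of the gluing, if `Q` starts at time `c`. -/
def glueLo {K : Type*} [Add K] (p : P.carrier → K) (q : Q.carrier → K) (c : K) :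
    GlueCarrier P Q → K
  | Sum.inl x => p x
  | Sum.inr y => q y.1 + c

variable (P Q)

/-- The gluing composition `P * Q`. -/
noncomputable def glue : Ipomset α where
  carrier := GlueCarrier P Q
  finite := have := P.finite; have := Q.finite; inferInstance
  prec := gluePrec P Q f
  evord := Relation.TransGen (glueEvordStep P Q f)
  source := inP P Q '' P.source
  target := inQ P Q f '' Q.target
  label := Sum.elim P.label (fun y => Q.label y.1)
  prec_irrefl := by
    rintro (x | y)
    · rw [gluePrec_inl_inl]; exact P.prec_irrefl x
    · rw [gluePrec_inr_inr]; exact Q.prec_irrefl y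
  prec_trans := by
    rintro (x | x) (y | y) (z | z) h1 h2
    · rw [gluePrec_inl_inl] at *; exact P.prec_trans _ _ _ h1 h2
    · rw [gluePrec_inl_inl] at h1
      rw [gluePrec_inl_inr]
      exact fun hx => absurd h1 (P.target_maximal x hx y)
    · exact absurd h2 (gluePrec_inr_inl f)
    · rw [gluePrec_inl_inr] at *
      rw [gluePrec_inr_inr] at h2
      exact fun hx => Q.prec_trans _ _ _ (h1 hx) h2
    · exact absurd h1 (gluePrec_inr_inl f)
    · exact absurd h1 (gluePrec_inr_inl f)
    · exact absurd h2 (gluePrec_inr_inl f)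
    · rw [gluePrec_inr_inr] at *; exact Q.prec_trans _ _ _ h1 h2
  evord_irrefl := by
    rintro (x | y) h
    · exact P.evord_irrefl x ((evord_inP_iff f).1 h)
    · rw [(inr_eq_inQ f).2 rfl] at h
      exact Q.evord_irrefl _ ((evord_inQ_iff f).1 h)
  evord_trans _ _ _ := Relation.TransGen.trans
  comparable := by
    rintro (x | x) (y | y) h
    · rw [gluePrec_inl_inl, gluePrec_inl_inl]
      have e := @evord_inP_iff α P Q f
      unfold inP at e
      rw [e, e]
      exact P.comparable x y (fun k => h (congrArg Sum.inl k))
    · rw [gluePrec_inl_inr]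
      by_cases hx : x ∈ P.target
      · have e1 : (Sum.inl x : GlueCarrier P Q) = inQ P Q f _ := (inl_eq_inQ f).2 ⟨hx, rfl⟩
        have e2 : (Sum.inr y : GlueCarrier P Q) = inQ P Q f _ := (inr_eq_inQ f).2 rfl
        rw [e1, e2, evord_inQ_iff, evord_inQ_iff]
        rcases Q.comparable (f.toEquiv ⟨x, hx⟩ : Q.source).1 y.1
          (fun k => y.2 (k ▸ (f.toEquiv ⟨x, hx⟩ : Q.source).2)) with k | k | k
        · exact Or.inl fun _ => k
        · exact absurd k (Q.source_minimal _ (f.toEquiv ⟨x, hx⟩ : Q.source).2 _)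
        · exact Or.inr (Or.inr k)
      · exact Or.inl fun k => absurd k hx
    · rw [gluePrec_inl_inr]
      by_cases hy : y ∈ P.target
      · have e1 : (Sum.inl y : GlueCarrier P Q) = inQ P Q f _ := (inl_eq_inQ f).2 ⟨hy, rfl⟩
        have e2 : (Sum.inr x : GlueCarrier P Q) = inQ P Q f _ := (inr_eq_inQ f).2 rfl
        rw [e1, e2, evord_inQ_iff, evord_inQ_iff]
        rcases Q.comparable (f.toEquiv ⟨y, hy⟩ : Q.source).1 x.1
          (fun k => x.2 (k ▸ (f.toEquiv ⟨y, hy⟩ : Q.source).2)) with k | k | k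
        · exact Or.inr (Or.inl fun _ => k)
        · exact absurd k (Q.source_minimal _ (f.toEquiv ⟨y, hy⟩ : Q.source).2 _)
        · exact Or.inr (Or.inr k.symm)
      · exact Or.inr (Or.inl fun k => absurd k hy)
    · rw [gluePrec_inr_inr, gluePrec_inr_inr]
      have e1 : (Sum.inr x : GlueCarrier P Q) = inQ P Q f _ := (inr_eq_inQ f).2 rfl
      have e2 : (Sum.inr y : GlueCarrier P Q) = inQ P Q f _ := (inr_eq_inQ f).2 rfl
      rw [e1, e2, evord_inQ_iff, evord_inQ_iff]
      exact Q.comparable x.1 y.1 (fun k => h (congrArg Sum.inr (Subtype.ext k)))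
  source_minimal := by
    rintro _ ⟨x, hx, rfl⟩ (y | y)
    · exact fun h => P.source_minimal x hx y ((gluePrec_inl_inl f).1 h)
    · exact gluePrec_inr_inl f
  target_maximal := by
    rintro _ ⟨q, hq, rfl⟩ b h
    rcases hc : inQ P Q f q with x | y
    · rw [hc] at h
      obtain ⟨hx, e⟩ := (inl_eq_inQ f).1 hc.symm
      rcases b with b | b
      · exact P.target_maximal x hx b ((gluePrec_inl_inl f).1 h)
      · exact Q.target_maximal q hq b (e ▸ (gluePrec_inl_inr f).1 h hx)
    · rw [hc] at h
      obtain rfl := (inr_eq_inQ f).1 hc.symm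
      rcases b with b | b
      · exact gluePrec_inr_inl f h
      · exact Q.target_maximal _ hq b ((gluePrec_inr_inr f).1 h)
  interval := by
    have := P.finite
    have := Q.finite
    obtain ⟨lp, hp, hp1, hp2⟩ := P.interval
    obtain ⟨lq, hq, hq1, hq2⟩ := Q.interval
    obtain ⟨M, hM⟩ := (Set.finite_range hp).bddAbove
    obtain ⟨m, hm⟩ := (Set.finite_range lq).bddBelow
    have hM' : ∀ x, hp x ≤ M := fun x => hM ⟨x, rfl⟩
    have hm' : ∀ y, m ≤ lq y := fun y => hm ⟨y, rfl⟩
    refine ⟨glueLo lp lq (M - m + 1), glueHi f hp hq (M - m + 1), ?_, ?_⟩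
    · rintro (x | y)
      · simp only [glueLo, glueHi]
        split_ifs with h
        · linarith [hp1 x, hM' x, hq1 (f.toEquiv ⟨x, h⟩ : Q.source).1,
            hm' (f.toEquiv ⟨x, h⟩ : Q.source).1]
        · exact hp1 x
      · simp only [glueLo, glueHi]
        linarith [hq1 y.1]
    · rintro (x | x) (y | y)
      · rw [gluePrec_inl_inl, hp2]
        simp only [glueLo, glueHi]
        split_ifs with h
        · refine iff_of_false (fun k => P.target_maximal x h y ((hp2 _ _).2 k)) ?_
          linarith [hp1 y, hM' y, hq1 (f.toEquiv ⟨x, h⟩ : Q.source).1,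
            hm' (f.toEquiv ⟨x, h⟩ : Q.source).1]
        · exact Iff.rfl
      · rw [gluePrec_inl_inr]
        simp only [glueLo, glueHi]
        split_ifs with h
        · rw [add_lt_add_iff_right, ← hq2]
          exact ⟨fun k => k h, fun k _ => k⟩
        · refine iff_of_true (fun k => absurd k h) ?_
          linarith [hM' x, hm' y.1]
      · refine iff_of_false (gluePrec_inr_inl f) ?_
        simp only [glueLo, glueHi]
        linarith [hp1 y, hM' y, hq1 x.1, hm' x.1]
      · rw [gluePrec_inr_inr, hq2]
        simp only [glueLo, glueHi]
        rw [add_lt_add_iff_right]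

/-- The source interface of `P * Q` is that of `P`. -/
noncomputable def glueSource : (P.glue Q f).sourceConclist.Iso P.sourceConclist :=
  Conclist.Iso.symm
  { toEquiv := Equiv.Set.image (inP P Q) P.source Sum.inl_injective
    map_evord := fun _ _ => evord_inP_iff f
    map_label := fun _ => rfl }

/-- The target interface of `P * Q` is that of `Q`. -/
noncomputable def glueTarget : (P.glue Q f).targetConclist.Iso Q.targetConclist :=
  Conclist.Iso.symm
  { toEquiv := Equiv.Set.image (inQ P Q f) Q.target (inQ_injective f)
    map_evord := fun _ _ => evord_inQ_iff f
    map_label := fun y => by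
      change (Sum.elim P.label (fun y => Q.label y.1)) (inQ P Q f y.1) = Q.label y.1
      by_cases h : y.1 ∈ Q.source
      · rw [inQ_of_mem f h]
        exact f.symm.map_label ⟨y.1, h⟩
      · rw [inQ_of_notMem f h]
        rfl }

end Glue

end Ipomset

/-- Ipomsets up to isomorphism. -/
def IPoms (α : Type u) : Type (max 1 u) := Quotient (Ipomset.setoid α)

namespace IPoms

variable {α : Type u}

/-- The isomorphism class of an ipomset. -/
def mk (P : Ipomset α) : IPoms α := Quotient.mk _ P

/-- `p * q` is defined and equal to `r`. -/
def IsGlue (p q r : IPoms α) : Prop :=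
  ∃ (P Q : Ipomset α) (f : P.targetConclist.Iso Q.sourceConclist),
    mk P = p ∧ mk Q = q ∧ mk (P.glue Q f) = r

/-- The gluing `p₁ * ⋯ * pₙ` of the word `p₁ ⋯ pₙ`, `n ≥ 1`, is defined and equal to `r`. -/
inductive GluesTo : List (IPoms α) → IPoms α → Prop
  | single (p : IPoms α) : GluesTo [p] p
  | snoc {w : List (IPoms α)} {p q r : IPoms α} :
      GluesTo w p → IsGlue p q r → GluesTo (w ++ [q]) r

end IPoms

/-- The alphabet `St ∪ Te` of starters and terminators. -/
def StTe (α : Type u) : Type (max 1 u) :=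
  {p : IPoms α // ∃ P : Ipomset α, IPoms.mk P = p ∧ (P.IsStarter ∨ P.IsTerminator)}

namespace StTe

variable {α : Type u}

def identity (U : Conclist α) : StTe α :=
  ⟨IPoms.mk (Ipomset.identity U), _, rfl, Or.inl ⟨fun _ _ h => h, rfl⟩⟩

def starter (U : Conclist α) (A : Set U.carrier) : StTe α :=
  ⟨IPoms.mk (Ipomset.starter U A), _, rfl, Or.inl ⟨fun _ _ h => h, rfl⟩⟩

def terminator (U : Conclist α) (A : Set U.carrier) : StTe α :=
  ⟨IPoms.mk (Ipomset.terminator U A), _, rfl, Or.inr ⟨fun _ _ h => h, rfl⟩⟩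

end StTe

/-! ### Timed ipomsets -/

/-- A timed ipomset: an ipomset with activity intervals `[lo x, hi x]` and a duration. -/
structure TIpomset (α : Type u) extends Ipomset α where
  lo : carrier → ℝ≥0
  hi : carrier → ℝ≥0
  dur : ℝ≥0
  lo_le_hi : ∀ x, lo x ≤ hi x
  hi_le_dur : ∀ x, hi x ≤ dur
  lo_source : ∀ x ∈ source, lo x = 0
  hi_target : ∀ x ∈ target, hi x = dur
  prec_of_lt : ∀ x y, hi x < lo y → prec x y
  le_of_prec : ∀ x y, prec x y → hi x ≤ lo y

namespace TIpomset

variable {α : Type u}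

/-- Isomorphisms of timed ipomsets. -/
structure IsIso (P Q : TIpomset α) (f : P.carrier ≃ Q.carrier) : Prop where
  isIso : Ipomset.IsIso P.toIpomset Q.toIpomset f
  lo : ∀ x, Q.lo (f x) = P.lo x
  hi : ∀ x, Q.hi (f x) = P.hi x
  dur : P.dur = Q.dur

instance setoid (α : Type u) : Setoid (TIpomset α) where
  r P Q := ∃ f, IsIso P Q f
  iseqv :=
    ⟨fun P => ⟨_, Ipomset.IsIso.refl _, fun _ => rfl, fun _ => rfl, rfl⟩,
      fun ⟨f, h⟩ => ⟨_, h.isIso.symm, fun x => by simpa using (h.lo (f.symm x)).symm,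
        fun x => by simpa using (h.hi (f.symm x)).symm, h.dur.symm⟩,
      fun ⟨_, h⟩ ⟨_, k⟩ => ⟨_, h.isIso.trans k.isIso, fun _ => (k.lo _).trans (h.lo _),
        fun _ => (k.hi _).trans (h.hi _), h.dur.trans k.dur⟩⟩

open Ipomset in
/-- The gluing composition of timed ipomsets. -/
noncomputable def glue (P Q : TIpomset α)
    (f : P.toIpomset.targetConclist.Iso Q.toIpomset.sourceConclist) : TIpomset α where
  toIpomset := P.toIpomset.glue Q.toIpomset f
  lo := glueLo P.lo Q.lo P.dur
  hi := glueHi f P.hi Q.hi P.dur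
  dur := P.dur + Q.dur
  lo_le_hi := by
    rintro (x | y)
    · simp only [glueLo, glueHi]
      split_ifs with h
      · exact ((P.lo_le_hi x).trans (P.hi_le_dur x)).trans le_add_self
      · exact P.lo_le_hi x
    · simp only [glueLo, glueHi]
      gcongr
      exact Q.lo_le_hi y.1
  hi_le_dur := by
    rintro (x | y)
    · simp only [glueHi]
      split_ifs with h
      · rw [add_comm]; gcongr; exact Q.hi_le_dur _
      · exact (P.hi_le_dur x).trans le_self_add
    · simp only [glueHi]
      rw [add_comm]; gcongr; exact Q.hi_le_dur _
  lo_source := by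
    rintro _ ⟨x, hx, rfl⟩
    exact P.lo_source x hx
  hi_target := by
    rintro _ ⟨q, hq, rfl⟩
    rcases hc : inQ P.toIpomset Q.toIpomset f q with x | y
    · obtain ⟨hx, rfl⟩ := (inl_eq_inQ f).1 hc.symm
      simp only [glueHi, dif_pos hx]
      rw [Q.hi_target _ hq, add_comm]
    · obtain rfl := (inr_eq_inQ f).1 hc.symm
      simp only [glueHi]
      rw [Q.hi_target _ hq, add_comm]
  prec_of_lt := by
    rintro (x | x) (y | y) h
    · refine (gluePrec_inl_inl f).2 ?_
      simp only [glueLo, glueHi] at h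
      split_ifs at h with hx
      · exact absurd (h.trans_le ((P.lo_le_hi y).trans (P.hi_le_dur y)))
          (not_lt.2 le_add_self)
      · exact P.prec_of_lt x y h
    · refine (gluePrec_inl_inr f).2 fun hx => ?_
      simp only [glueLo, glueHi, dif_pos hx, add_lt_add_iff_right] at h
      exact Q.prec_of_lt _ _ h
    · simp only [glueLo, glueHi] at h
      exact absurd (h.trans_le ((P.lo_le_hi y).trans (P.hi_le_dur y))) (not_lt.2 le_add_self)
    · refine (gluePrec_inr_inr f).2 ?_
      simp only [glueLo, glueHi, add_lt_add_iff_right] at h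
      exact Q.prec_of_lt _ _ h
  le_of_prec := by
    rintro (x | x) (y | y) h
    · have h := (gluePrec_inl_inl f).1 h
      simp only [glueLo, glueHi]
      split_ifs with hx
      · exact absurd h (P.target_maximal x hx y)
      · exact P.le_of_prec x y h
    · have h := (gluePrec_inl_inr f).1 h
      simp only [glueLo, glueHi]
      split_ifs with hx
      · gcongr; exact Q.le_of_prec _ _ (h hx)
      · exact (P.hi_le_dur x).trans le_add_self
    · exact absurd h (gluePrec_inr_inl f)
    · have h := (gluePrec_inr_inr f).1 h
      simp only [glueLo, glueHi]
      gcongr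
      exact Q.le_of_prec _ _ h

/-- The identity on `U`, with every activity interval equal to `[0, d]` and duration `d`. -/
def wait (U : Conclist α) (d : ℝ≥0) : TIpomset α where
  toIpomset := Ipomset.identity U
  lo _ := 0
  hi _ := d
  dur := d
  lo_le_hi _ := zero_le
  hi_le_dur _ := le_rfl
  lo_source _ _ := rfl
  hi_target _ _ := rfl
  prec_of_lt _ _ h := absurd h not_lt_zero
  le_of_prec _ _ h := h.elim

/-- An ipomset with empty precedence, with all activity intervals `[0, 0]` and duration `0`. -/
def instant (P : Ipomset α) (_ : P.IsDiscrete) : TIpomset α where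
  toIpomset := P
  lo _ := 0
  hi _ := 0
  dur := 0
  lo_le_hi _ := le_rfl
  hi_le_dur _ := le_rfl
  lo_source _ _ := rfl
  hi_target _ _ := rfl
  prec_of_lt _ _ k := absurd k (lt_irrefl _)
  le_of_prec _ _ _ := le_rfl

/-- A timed ipomset whose interfaces are (isomorphic to) the conclists `U` and `V`. -/
structure Between (U V : Conclist α) where
  tip : TIpomset α
  src : tip.toIpomset.sourceConclist.Iso U
  tgt : tip.toIpomset.targetConclist.Iso V

/-- Gluing of timed ipomsets with matching interfaces. -/
noncomputable def Between.comp {U V W : Conclist α} (P : Between U V) (Q : Between V W) :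
    Between U W where
  tip := P.tip.glue Q.tip (P.tgt.trans Q.src.symm)
  src := (Ipomset.glueSource _ _ _).trans P.src
  tgt := (Ipomset.glueTarget _ _ _).trans Q.tgt

end TIpomset

/-- Timed ipomsets up to isomorphism. -/
def TIPoms (α : Type u) : Type (max 1 u) := Quotient (TIpomset.setoid α)

/-- The isomorphism class of a timed ipomset. -/
def TIPoms.mk {α : Type u} (P : TIpomset α) : TIPoms α := Quotient.mk _ P

/-- The untiming. -/
def TIPoms.unt {α : Type u} : TIPoms α → IPoms α :=
  Quotient.map TIpomset.toIpomset (fun _ _ ⟨f, h⟩ => ⟨f, h.isIso⟩)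

/-! ### Clock constraints -/

/-- The comparisons `<`, `≤`, `≥`, `>`. -/
inductive Comparison
  | lt | le | ge | gt

/-- Comparison of a real number with a natural number. -/
def Comparison.Holds : Comparison → ℝ≥0 → ℕ → Prop
  | lt, t, k => t < k
  | le, t, k => t ≤ k
  | ge, t, k => t ≥ k
  | gt, t, k => t > k

/-- Clock constraints over `C`. -/
inductive ClockConstraint (C : Type v)
  | cmp (c : C) (r : Comparison) (k : ℕ) : ClockConstraint C
  | and (φ₁ φ₂ : ClockConstraint C) : ClockConstraint C

namespace ClockConstraint

variable {C : Type v}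

/-- `v ⊨ φ`. -/
def Sat (v : C → ℝ≥0) : ClockConstraint C → Prop
  | cmp c r k => r.Holds (v c) k
  | and φ₁ φ₂ => Sat v φ₁ ∧ Sat v φ₂

/-- The maximal constant of a constraint. -/
def maxConst : ClockConstraint C → ℕ
  | cmp _ _ k => k
  | and φ₁ φ₂ => max φ₁.maxConst φ₂.maxConst

end ClockConstraint

/-- The valuation `v + d`. -/
def delayBy {C : Type v} (v : C → ℝ≥0) (d : ℝ≥0) : C → ℝ≥0 := fun c => v c + d

open Classical in
/-- The valuation `v[R ← 0]`. -/
noncomputable def resetClocks {C : Type v} (v : C → ℝ≥0) (R : Set C) : C → ℝ≥0 :=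
  fun c => if c ∈ R then 0 else v c

/-! ### Higher-dimensional timed automata -/

/-- A precubical set with set of cells `X`. For a set `A` of events of a cell `x`, `face false x A`
is the lower face `δ⁰_A(x)` and `face true x A` the upper face `δ¹_A(x)`. The events of a face are
those of `ev x ∖ A`, up to (unique) isomorphism. -/
structure PrecubicalSet (α : Type u) (X : Type w) where
  ev : X → Conclist α
  face : Bool → (x : X) → Set (ev x).carrier → X
  faceIso : ∀ ν x A, (ev (face ν x A)).Iso ((ev x).remove A)
  face_comm : ∀ (ν μ : Bool) (x : X) (A B : Set (ev x).carrier), Disjoint A B →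
    face μ (face ν x A) {e | ((faceIso ν x A).toEquiv e : (Aᶜ : Set (ev x).carrier)).1 ∈ B} =
    face ν (face μ x B) {e | ((faceIso μ x B).toEquiv e : (Bᶜ : Set (ev x).carrier)).1 ∈ A}

/-- A higher-dimensional timed automaton over the alphabet `α`, with clocks `C` and cells `L`. -/
structure HDTA (α : Type u) (C : Type v) (L : Type w) extends PrecubicalSet α L where
  init : Set L
  accept : Set L
  inv : L → ClockConstraint C
  exit : L → Set C

namespace HDTA

variable {α : Type u} {C : Type v} {L : Type w} (A : HDTA α C L)

/-- States of the operational semantics: pairs of a cell and a valuation satisfying its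
invariant. -/
structure State where
  cell : L
  val : C → ℝ≥0
  sat : (A.inv cell).Sat val

/-- Moves of the operational semantics: delays, starts of a set of events, and terminations of a
set of events. -/
inductive Move (s t : A.State) : Type (max v w)
  | delay (d : ℝ≥0) (hcell : t.cell = s.cell) (hval : t.val = delayBy s.val d)
      (hinv : ∀ d' ≤ d, (A.inv s.cell).Sat (delayBy s.val d'))
  | up (U : Set (A.ev t.cell).carrier) (hcell : s.cell = A.face false t.cell U)
      (hval : t.val = resetClocks s.val (A.exit s.cell))
  | down (U : Set (A.ev s.cell).carrier) (hcell : t.cell = A.face true s.cell U)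
      (hval : t.val = resetClocks s.val (A.exit s.cell))

variable {A}

/-- The observable content of a single move. -/
def Move.content {s t : A.State} : A.Move s t → TIpomset.Between (A.ev s.cell) (A.ev t.cell)
  | .delay d hcell _ _ =>
    { tip := TIpomset.wait (A.ev s.cell) d
      src := Conclist.restrictUniv _
      tgt := (Conclist.restrictUniv _).trans (Conclist.Iso.ofEq (congrArg A.ev hcell.symm)) }
  | .up U hcell _ =>
    { tip := TIpomset.instant (Ipomset.starter (A.ev t.cell) U) (fun _ _ h => h)
      src := (A.faceIso false t.cell U).symm.trans
        (Conclist.Iso.ofEq (congrArg A.ev hcell.symm))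
      tgt := Conclist.restrictUniv _ }
  | .down U hcell _ =>
    { tip := TIpomset.instant (Ipomset.terminator (A.ev s.cell) U) (fun _ _ h => h)
      src := Conclist.restrictUniv _
      tgt := (A.faceIso true s.cell U).symm.trans
        (Conclist.Iso.ofEq (congrArg A.ev hcell.symm)) }

/-- The label of a move in the region automaton: an identity for a delay, otherwise the starter or
terminator of the move. -/
def Move.letter {s t : A.State} : A.Move s t → StTe α
  | .delay _ _ _ _ => StTe.identity (A.ev s.cell)
  | .up U _ _ => StTe.starter (A.ev t.cell) U
  | .down U _ _ => StTe.terminator (A.ev s.cell) U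

variable (A)

/-- Paths of the operational semantics: finite sequences of consecutive moves. -/
inductive Path (s : A.State) : A.State → Type (max v w)
  | nil : Path s s
  | snoc {t t' : A.State} : Path s t → A.Move t t' → Path s t'

variable {A}

/-- The observable content of a path. -/
noncomputable def Path.content {s : A.State} :
    {t : A.State} → A.Path s t → TIpomset.Between (A.ev s.cell) (A.ev t.cell)
  | _, .nil =>
    { tip := TIpomset.wait (A.ev s.cell) 0
      src := Conclist.restrictUniv _
      tgt := Conclist.restrictUniv _ }
  | _, .snoc π m => (Path.content π).comp m.content

variable (A)

/-- The language: the observable contents of the accepting paths, which start in an initial cell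
with all clocks at zero and end in an accepting cell. -/
def language : Set (TIPoms α) :=
  {p | ∃ (s t : A.State) (π : A.Path s t), s.cell ∈ A.init ∧ s.val = (fun _ => 0) ∧
    t.cell ∈ A.accept ∧ TIPoms.mk π.content.tip = p}

/-! ### Regions -/

section Region

variable [Fintype L]

/-- The maximal constant in the invariants of `A` (`0` if there is none). -/
def maxConst : ℕ := Finset.univ.sup fun l => (A.inv l).maxConst

/-- Region equivalence of valuations. -/
structure RegionEquiv (v v' : C → ℝ≥0) : Prop where
  floor : ∀ x, ⌊(v x : ℝ)⌋ = ⌊(v' x : ℝ)⌋ ∨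
    ((A.maxConst : ℝ) < (v x : ℝ) ∧ (A.maxConst : ℝ) < (v' x : ℝ))
  fract_zero : ∀ x, Int.fract (v x : ℝ) = 0 ↔ Int.fract (v' x : ℝ) = 0
  fract_le : ∀ x y, Int.fract (v x : ℝ) ≤ Int.fract (v y : ℝ) ↔
    Int.fract (v' x : ℝ) ≤ Int.fract (v' y : ℝ)

def regionSetoid : Setoid (C → ℝ≥0) where
  r := A.RegionEquiv
  iseqv :=
    { refl := fun _ => ⟨fun _ => Or.inl rfl, fun _ => Iff.rfl, fun _ _ => Iff.rfl⟩
      symm := fun h => ⟨fun x => (h.floor x).imp Eq.symm And.symm, fun x => (h.fract_zero x).symm,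
        fun x y => (h.fract_le x y).symm⟩
      trans := by
        intro v₁ v₂ v₃ h k
        refine ⟨fun x => ?_, fun x => (h.fract_zero x).trans (k.fract_zero x),
          fun x y => (h.fract_le x y).trans (k.fract_le x y)⟩
        have aux : ∀ {v v' : C → ℝ≥0}, A.RegionEquiv v v' →
            ((A.maxConst : ℝ) < (v x : ℝ) → (A.maxConst : ℝ) < (v' x : ℝ)) := by
          intro v v' h hM
          rcases h.floor x with e | e
          · have z := h.fract_zero x
            have h1 : ((A.maxConst : ℤ) : ℝ) ≤ v' x :=
              Int.le_floor.1 (e ▸ Int.le_floor.2 (by exact_mod_cast hM.le))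
            have h1' : (A.maxConst : ℝ) ≤ v' x := by exact_mod_cast h1
            refine lt_of_le_of_ne h1' fun h2 => ?_
            have h3 : Int.fract (v x : ℝ) = 0 := z.2 (by rw [← h2]; simp)
            rw [Int.fract, sub_eq_zero, e, ← h2, Int.floor_natCast] at h3
            exact hM.ne' (h3.trans (Int.cast_natCast _))
          · exact e.2
        rcases h.floor x with e | e
        · rcases k.floor x with e' | e'
          · exact Or.inl (e.trans e')
          · refine Or.inr ⟨?_, e'.2⟩
            exact aux ⟨fun x => (h.floor x).imp Eq.symm And.symm, fun x => (h.fract_zero x).symm,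
              fun x y => (h.fract_le x y).symm⟩ e'.1
        · exact Or.inr ⟨e.1, aux k e.2⟩ }

/-- Regions: the classes of region equivalence. -/
def Region : Type v := Quotient A.regionSetoid

/-- The region of a valuation. -/
def region (v : C → ℝ≥0) : A.Region := Quotient.mk A.regionSetoid v

/-- States of the region automaton: pairs of a cell and a region contained in its invariant, and
an extra copy of every initial cell. -/
inductive RegionState : Type (max v w)
  | start (l : L) (hl : l ∈ A.init)
  | cell (l : L) (r : A.Region) (hr : ∀ v, A.region v = r → (A.inv l).Sat v)

/-- Transitions of the region automaton. The copy of an initial cell leads to the cell itself with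
all clocks at zero; all other transitions are induced by the moves of `A`. -/
inductive RegionStep : A.RegionState → StTe α → A.RegionState → Prop
  | enter (l : L) (hl : l ∈ A.init)
      (hr : ∀ v, A.region v = A.region (fun _ => 0) → (A.inv l).Sat v) :
      RegionStep (.start l hl) (StTe.identity (A.ev l)) (.cell l (A.region fun _ => 0) hr)
  | move {s t : A.State} (m : A.Move s t)
      (hs : ∀ v, A.region v = A.region s.val → (A.inv s.cell).Sat v)
      (ht : ∀ v, A.region v = A.region t.val → (A.inv t.cell).Sat v) :
      RegionStep (.cell s.cell (A.region s.val) hs) m.letter (.cell t.cell (A.region t.val) ht)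

/-- The region automaton, as a nondeterministic automaton over starters and terminators. -/
def regionAutomaton : NFA (StTe α) A.RegionState where
  step p a := {q | A.RegionStep p a q}
  start := {p | ∃ l hl, p = .start l hl}
  accept := {p | ∃ l r hr, p = .cell l r hr ∧ l ∈ A.accept}

end Region

end HDTA

/-! ### Uniqueness of gluings up to isomorphism -/

namespace Conclist

variable {α : Type u}

/-! The letter of a transition is the untiming of the content of the move that induces it
(`Move.mk_content`), and the content of a path is the gluing of the contents of its moves. A path
and a run using the same letters in the same order therefore have the same untimed gluing, and it
remains to trace paths by runs and runs by paths.

Paths project to runs by replacing valuations with their regions (`Path.exists_run`); this is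
possible because an invariant, whose constants are at most M, cannot separate two valuations of one
region.

For the converse, consecutive transitions of a run may be induced by moves from different valuations
of the same region. Each move must be replayed from the valuation actually reached, keeping its
letter and the target region: region equivalence is a time-abstract bisimulation
(`Move.exists_of_region_eq`). Resets are harmless. For delays, `RegionEquiv.exists_delay` keeps the
integral part and chooses a fractional part lying in the same position relative to the times at
which clocks become integers; intermediate invariants then hold by convexity
(`ClockConstraint.sat_of_between`).

A word determines its gluing because isomorphisms of conclists are unique, so that gluing is well
defined on isomorphism classes (`IsIso.glue`, `GluesTo.unique`). A region is coded by finitely many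
bounded data, whence finiteness. -/

theorem Iso.unique {U V : Conclist α} (f g : Iso U V) (x : U.carrier) :
    f.toEquiv x = g.toEquiv x := by
  have := U.finite
  have : Std.Irrefl U.evord := ⟨U.evord_irrefl⟩
  have : IsTrans _ U.evord := ⟨U.evord_trans⟩
  have : Std.Irrefl V.evord := ⟨V.evord_irrefl⟩
  have : Std.Trichotomous V.evord :=
    ⟨fun x y h h' => by_contra fun e => (V.evord_total x y e).elim h h'⟩
  have : IsWellFounded U.carrier U.evord := ⟨Finite.wellFounded_of_trans_of_irrefl _⟩
  let F (k : Iso U V) : U.evord ≃r V.evord := ⟨k.toEquiv, fun {x y} => k.map_evord x y⟩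
  -- Finite strict total orders are well-orders, and a well-order embeds as an initial segment in at
  -- most one way.
  have e : (F f).toInitialSeg = (F g).toInitialSeg := Subsingleton.elim _ _
  exact congrArg (fun k => k x) e

end Conclist

namespace Ipomset

variable {α : Type u} {P Q P' Q' : Ipomset α}

/-- The isomorphism of target interfaces induced by an isomorphism. -/
def IsIso.targetIso {g : P.carrier ≃ P'.carrier} (hg : IsIso P P' g) :
    P.targetConclist.Iso P'.targetConclist where
  toEquiv := g.subtypeEquiv fun x => (hg.target x).symm
  map_evord x y := (hg.evord x.1 y.1 (P.target_maximal _ x.2 _) (P.target_maximal _ y.2 _)).symm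
  map_label x := hg.label x.1

/-- The isomorphism of source interfaces induced by an isomorphism. -/
def IsIso.sourceIso {g : P.carrier ≃ P'.carrier} (hg : IsIso P P' g) :
    P.sourceConclist.Iso P'.sourceConclist where
  toEquiv := g.subtypeEquiv fun x => (hg.source x).symm
  map_evord x y := (hg.evord x.1 y.1 (P.source_minimal _ y.2 _) (P.source_minimal _ x.2 _)).symm
  map_label x := hg.label x.1

/-- No compatibility between `f` and `f'` has to be assumed: both ways around the square are
isomorphisms from the target conclist of `P` to the source conclist of `Q'`, and there is only one
such isomorphism. -/
theorem IsIso.glue_compat {g : P.carrier ≃ P'.carrier} {h : Q.carrier ≃ Q'.carrier}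
    (hg : IsIso P P' g) (hh : IsIso Q Q' h)
    (f : P.targetConclist.Iso Q.sourceConclist) (f' : P'.targetConclist.Iso Q'.sourceConclist)
    {x : P.carrier} (hx : x ∈ P.target) (hx' : g x ∈ P'.target) :
    (f'.toEquiv ⟨g x, hx'⟩ : Q'.source).1 = h (f.toEquiv ⟨x, hx⟩ : Q.source).1 :=
  congrArg Subtype.val
    ((hg.targetIso.trans f').unique (f.trans hh.sourceIso) (⟨x, hx⟩ : P.target))

/-- Gluing respects isomorphisms. -/
theorem IsIso.glue {g : P.carrier ≃ P'.carrier} {h : Q.carrier ≃ Q'.carrier}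
    (hg : IsIso P P' g) (hh : IsIso Q Q' h)
    (f : P.targetConclist.Iso Q.sourceConclist) (f' : P'.targetConclist.Iso Q'.sourceConclist) :
    ∃ F, IsIso (P.glue Q f) (P'.glue Q' f') F := by
  let F : GlueCarrier P Q ≃ GlueCarrier P' Q' :=
    Equiv.sumCongr g (h.subtypeEquiv fun y => not_congr (hh.source y).symm)
  have hFP : ∀ x, F (inP P Q x) = inP P' Q' (g x) := fun _ => rfl
  -- On events outside the source interface this holds by construction; on shared events, which `F`
  -- moves by `g`, it is `glue_compat`.
  have hFQ : ∀ y, F (inQ P Q f y) = inQ P' Q' f' (h y) := by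
    intro y
    rcases hc : inQ P Q f y with x | z
    · obtain ⟨hx, rfl⟩ := (inl_eq_inQ f).1 hc.symm
      have hx' := (hg.target x).2 hx
      exact (inl_eq_inQ f').2 ⟨hx', hg.glue_compat hh f f' hx hx'⟩
    · obtain rfl := (inr_eq_inQ f).1 hc.symm
      exact (inr_eq_inQ f').2 rfl
  have evP : ∀ x y, ¬ gluePrec P Q f (inP P Q x) (inP P Q y) →
      ¬ gluePrec P Q f (inP P Q y) (inP P Q x) →
      (Relation.TransGen (glueEvordStep P Q f) (inP P Q x) (inP P Q y) ↔
      Relation.TransGen (glueEvordStep P' Q' f') (F (inP P Q x)) (F (inP P Q y))) := by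
    intro x y h1 h2
    rw [hFP, hFP, evord_inP_iff, evord_inP_iff]
    exact hg.evord x y (fun k => h1 ((gluePrec_inl_inl f).2 k))
      (fun k => h2 ((gluePrec_inl_inl f).2 k))
  have evQ : ∀ x y, ¬ gluePrec P Q f (inQ P Q f x) (inQ P Q f y) →
      ¬ gluePrec P Q f (inQ P Q f y) (inQ P Q f x) →
      (Relation.TransGen (glueEvordStep P Q f) (inQ P Q f x) (inQ P Q f y) ↔
      Relation.TransGen (glueEvordStep P' Q' f') (F (inQ P Q f x)) (F (inQ P Q f y))) := by
    intro x y h1 h2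
    rw [hFQ, hFQ, evord_inQ_iff, evord_inQ_iff]
    exact hh.evord x y (fun k => h1 (Or.inr (Or.inl ⟨x, y, rfl, rfl, k⟩)))
      (fun k => h2 (Or.inr (Or.inl ⟨y, x, rfl, rfl, k⟩)))
  have inrQ : ∀ z : {y : Q.carrier // y ∉ Q.source}, (Sum.inr z : GlueCarrier P Q)
      = inQ P Q f z.1 := fun z => (inr_eq_inQ f).2 rfl
  -- An event of `P` that does not precede an event of `Q` outside the interface is itself shared.
  -- Hence two concurrent events lie both in `P` or both in `Q`, and `evP` and `evQ` cover every
  -- pair on which the event order must be respected.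
  have inlQ : ∀ x z, ¬ gluePrec P Q f (Sum.inl x) (Sum.inr z) →
      ∃ y, (Sum.inl x : GlueCarrier P Q) = inQ P Q f y := by
    intro x z k
    rw [gluePrec_inl_inr] at k
    push Not at k
    obtain ⟨hx, -⟩ := k
    exact ⟨_, (inl_eq_inQ f).2 ⟨hx, rfl⟩⟩
  refine ⟨F, ?_, ?_, ?_, ?_, ?_⟩
  · intro a
    constructor
    · rintro ⟨x, hx, e⟩
      obtain ⟨x, rfl⟩ := g.surjective x
      exact ⟨x, (hg.source x).1 hx, F.injective ((hFP x).trans e)⟩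
    · rintro ⟨x, hx, rfl⟩
      exact ⟨g x, (hg.source x).2 hx, (hFP x).symm⟩
  · intro a
    constructor
    · rintro ⟨x, hx, e⟩
      obtain ⟨x, rfl⟩ := h.surjective x
      exact ⟨x, (hh.target x).1 hx, F.injective ((hFQ x).trans e)⟩
    · rintro ⟨x, hx, rfl⟩
      exact ⟨h x, (hh.target x).2 hx, (hFQ x).symm⟩
  · rintro (x | y)
    · exact hg.label x
    · exact hh.label y.1
  · rintro (x | x) (y | y)
    · exact (gluePrec_inl_inl f').trans ((hg.prec x y).trans (gluePrec_inl_inl f).symm)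
    · refine (gluePrec_inl_inr f').trans (Iff.trans ?_ (gluePrec_inl_inr f).symm)
      constructor
      · intro k hx
        have := k ((hg.target x).2 hx)
        rw [hg.glue_compat hh f f' hx] at this
        exact (hh.prec _ _).1 this
      · intro k hx'
        have hx := (hg.target x).1 hx'
        rw [hg.glue_compat hh f f' hx]
        exact (hh.prec _ _).2 (k hx)
    · exact iff_of_false (gluePrec_inr_inl f') (gluePrec_inr_inl f)
    · exact (gluePrec_inr_inr f').trans ((hh.prec x.1 y.1).trans (gluePrec_inr_inr f).symm)
  · rintro (x | x) (y | y) h1 h2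
    · exact evP x y h1 h2
    · obtain ⟨x', e⟩ := inlQ x y h1
      rw [e, inrQ y] at h1 h2 ⊢
      exact evQ _ _ h1 h2
    · obtain ⟨y', e⟩ := inlQ y x h2
      rw [e, inrQ x] at h1 h2 ⊢
      exact evQ _ _ h1 h2
    · rw [inrQ x, inrQ y] at h1 h2 ⊢
      exact evQ _ _ h1 h2

end Ipomset

namespace IPoms

variable {α : Type u}

theorem IsGlue.unique {p q r r' : IPoms α} (h : IsGlue p q r) (h' : IsGlue p q r') : r = r' := by
  obtain ⟨P, Q, f, rfl, rfl, rfl⟩ := h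
  obtain ⟨P', Q', f', hP, hQ, rfl⟩ := h'
  obtain ⟨g, hg⟩ := Quotient.exact hP
  obtain ⟨k, hk⟩ := Quotient.exact hQ
  exact (Quotient.sound (hg.glue hk f' f)).symm

theorem not_gluesTo_nil {p : IPoms α} : ¬ GluesTo [] p := by
  intro h
  generalize hw : ([] : List (IPoms α)) = w at h
  cases h <;> simp at hw

theorem gluesTo_singleton {p q : IPoms α} (h : GluesTo [p] q) : q = p := by
  generalize hw : [p] = w at h
  cases h with
  | single => simpa using hw.symm
  | @snoc w p' _ _ h _ =>
    obtain rfl : w = [] := by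
      have := congrArg List.length hw
      simpa using this
    exact (not_gluesTo_nil h).elim

/-- The word fixes the shape of the derivation: a one-letter word cannot arise by `snoc`, since the
empty word has no gluing. Otherwise the last letter is split off and `IsGlue.unique` applies. -/
theorem GluesTo.unique {w : List (IPoms α)} {p q : IPoms α} (h : GluesTo w p)
    (h' : GluesTo w q) : p = q := by
  induction h generalizing q with
  | single p => exact (gluesTo_singleton h').symm
  | @snoc w p a r h1 h2 ih =>
    generalize hw : w ++ [a] = w' at h'
    cases h' with
    | single =>
      obtain rfl : w = [] := by
        have := congrArg List.length hw
        simpa using this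
      exact (not_gluesTo_nil h1).elim
    | snoc h1' h2' =>
      obtain ⟨rfl, rfl⟩ := List.append_singleton_inj.1 hw
      obtain rfl := ih h1'
      exact h2.unique h2'

end IPoms

theorem StTe.map_val_concat {α : Type u} (x : List (StTe α)) (a : StTe α) :
    (x ++ [a]).map Subtype.val = x.map Subtype.val ++ [a.val] :=
  List.map_append

/-! ### Convexity of constraints and one-point extension of orders -/

namespace ClockConstraint

variable {C : Type v}

/-- Each atom bounds one clock from one side, so it is inherited from the lower or from the upper
valuation. It makes the invariant during a delay a matter of the two ends only. -/
theorem sat_of_between {φ : ClockConstraint C} {v₁ v₂ v₃ : C → ℝ≥0} (h₁ : Sat v₁ φ)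
    (h₃ : Sat v₃ φ) (h₁₂ : v₁ ≤ v₂) (h₂₃ : v₂ ≤ v₃) : Sat v₂ φ := by
  induction φ with
  | cmp c r k =>
    have h₁₂ := h₁₂ c
    have h₂₃ := h₂₃ c
    cases r <;> simp only [Sat, Comparison.Holds] at *
    · exact h₂₃.trans_lt h₃
    · exact h₂₃.trans h₃
    · exact ge_trans h₁₂ h₁
    · exact lt_of_lt_of_le h₁ h₁₂
  | and φ₁ φ₂ i₁ i₂ => exact ⟨i₁ h₁.1 h₃.1, i₂ h₁.2 h₃.2⟩

end ClockConstraint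

/-- If two finite families of points are ordered alike, then for every point `t` there is a point
in the same position relative to the second family as `t` is relative to the first. -/
theorem exists_same_position {ι : Type*} [Finite ι] {a a' : ι → ℝ}
    (h : ∀ i j, a i ≤ a j ↔ a' i ≤ a' j) (t : ℝ) :
    ∃ t', ∀ i, (a i ≤ t ↔ a' i ≤ t') ∧ (t ≤ a i ↔ t' ≤ a' i) := by
  classical
  have := Fintype.ofFinite ι
  have hlt : ∀ i j, a i < a j ↔ a' i < a' j := fun i j => by
    rw [← not_le, ← not_le, h]
  -- The pairs `(a i, a' i)` form a finite partial isomorphism of ℝ, and a single step of Cantor's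
  -- back-and-forth argument extends it to `t`.
  let f : Order.PartialIso ℝ ℝ := ⟨Finset.univ.image fun i => (a i, a' i), by
    simp only [Finset.mem_image, Finset.mem_univ, true_and]
    rintro _ ⟨i, rfl⟩ _ ⟨j, rfl⟩
    rcases lt_trichotomy (a i) (a j) with k | k | k
    · rw [(cmp_eq_lt_iff _ _).2 k, (cmp_eq_lt_iff _ _).2 ((hlt i j).1 k)]
    · have := le_antisymm ((h i j).1 k.le) ((h j i).1 k.ge)
      rw [(cmp_eq_eq_iff _ _).2 k, (cmp_eq_eq_iff _ _).2 this]
    · rw [(cmp_eq_gt_iff _ _).2 k, (cmp_eq_gt_iff _ _).2 ((hlt j i).1 k)]⟩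
  obtain ⟨t', ht'⟩ := Order.PartialIso.exists_across f t
  refine ⟨t', fun i => ?_⟩
  have e : cmp (a i) t = cmp (a' i) t' :=
    ht' (a i, a' i) (Finset.mem_image.2 ⟨i, Finset.mem_univ _, rfl⟩)
  exact ⟨le_iff_le_of_cmp_eq_cmp e, by
    rw [← not_lt, ← not_lt, lt_iff_lt_of_cmp_eq_cmp e]⟩

/-! ### Regions: bisimulation and finiteness -/

namespace HDTA

variable {α : Type u} {C : Type v} {L : Type w} {A : HDTA α C L}

section Region

variable [Fintype L]

theorem region_eq_iff {v v' : C → ℝ≥0} : A.region v = A.region v' ↔ A.RegionEquiv v v' :=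
  Quotient.eq (r := A.regionSetoid)

theorem RegionEquiv.symm {v v' : C → ℝ≥0} (h : A.RegionEquiv v v') : A.RegionEquiv v' v :=
  A.regionSetoid.symm h

/-- A lower bound by an integer depends only on the integral part, and above the maximal constant
both sides hold. -/
theorem RegionEquiv.natCast_le {v v' : C → ℝ≥0} (h : A.RegionEquiv v v') (x : C) {k : ℕ}
    (hk : k ≤ A.maxConst) : (k : ℝ≥0) ≤ v x ↔ (k : ℝ≥0) ≤ v' x := by
  have hk' : (k : ℝ) ≤ A.maxConst := by exact_mod_cast hk
  rw [← NNReal.coe_le_coe, ← NNReal.coe_le_coe, NNReal.coe_natCast]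
  rcases h.floor x with e | ⟨e, e'⟩
  · have h1 : ∀ r : ℝ, (k : ℝ) ≤ r ↔ (k : ℤ) ≤ ⌊r⌋ := fun r => by rw [Int.le_floor]; simp
    rw [h1, h1, e]
  · exact iff_of_true (hk'.trans e.le) (hk'.trans e'.le)

/-- Unlike a lower bound, an upper bound by an integer also depends on whether the value is itself
an integer; here `fract_zero` enters. -/
theorem RegionEquiv.le_natCast {v v' : C → ℝ≥0} (h : A.RegionEquiv v v') (x : C) {k : ℕ}
    (hk : k ≤ A.maxConst) : v x ≤ (k : ℝ≥0) ↔ v' x ≤ (k : ℝ≥0) := by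
  have hk' : (k : ℝ) ≤ A.maxConst := by exact_mod_cast hk
  rw [← NNReal.coe_le_coe, ← NNReal.coe_le_coe, NNReal.coe_natCast]
  rcases h.floor x with e | ⟨e, e'⟩
  · have h1 : ∀ r : ℝ, r ≤ k ↔ ⌊r⌋ < k ∨ (⌊r⌋ = k ∧ Int.fract r = 0) := by
      intro r
      rw [le_iff_lt_or_eq, Int.floor_lt, Int.cast_natCast]
      refine or_congr Iff.rfl ⟨fun e => by simp [e], fun ⟨e, e'⟩ => ?_⟩
      rw [← Int.floor_add_fract r, e, e', add_zero, Int.cast_natCast]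
    rw [h1, h1, e, h.fract_zero]
  · exact iff_of_false (hk'.trans_lt e).not_ge (hk'.trans_lt e').not_ge

theorem RegionEquiv.sat {v v' : C → ℝ≥0} (h : A.RegionEquiv v v') {φ : ClockConstraint C}
    (hφ : φ.maxConst ≤ A.maxConst) (hv : φ.Sat v) : φ.Sat v' := by
  induction φ with
  | cmp c r k =>
    have h1 := h.natCast_le c (k := k) hφ
    have h2 := h.le_natCast c (k := k) hφ
    cases r <;> simp only [ClockConstraint.Sat, Comparison.Holds] at *
    · rwa [← not_le, ← h1, not_le]
    · exact h2.1 hv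
    · exact h1.1 hv
    · rwa [gt_iff_lt, ← not_le, ← h2, not_le]
  | and φ₁ φ₂ i₁ i₂ =>
    exact ⟨i₁ ((le_max_left _ _).trans hφ) hv.1, i₂ ((le_max_right _ _).trans hφ) hv.2⟩

theorem RegionEquiv.sat_inv {v v' : C → ℝ≥0} (h : A.RegionEquiv v v') {l : L}
    (hv : (A.inv l).Sat v) : (A.inv l).Sat v' :=
  h.sat (Finset.le_sup (f := fun l => (A.inv l).maxConst) (Finset.mem_univ l)) hv

/-- This is the proof component that turns a state of `A` into a state of the region automaton. -/
theorem State.sat_of_region_eq (s : A.State) (v : C → ℝ≥0) (h : A.region v = A.region s.val) :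
    (A.inv s.cell).Sat v :=
  (region_eq_iff.1 h).symm.sat_inv s.sat

theorem RegionEquiv.reset {v v' : C → ℝ≥0} (h : A.RegionEquiv v v') (R : Set C) :
    A.RegionEquiv (resetClocks v R) (resetClocks v' R) := by
  -- Comparing a clock that is kept with one that is reset amounts to asking whether the former is
  -- an integer.
  have nonpos : ∀ r : ℝ, Int.fract r ≤ 0 ↔ Int.fract r = 0 := fun r =>
    ⟨fun k => le_antisymm k (Int.fract_nonneg r), fun k => k.le⟩
  refine ⟨fun x => ?_, fun x => ?_, fun x y => ?_⟩
  · by_cases hx : x ∈ R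
    · simp [resetClocks, hx]
    · simpa [resetClocks, hx] using h.floor x
  · by_cases hx : x ∈ R
    · simp [resetClocks, hx]
    · simpa [resetClocks, hx] using h.fract_zero x
  · by_cases hx : x ∈ R <;> by_cases hy : y ∈ R
    · simp [resetClocks, hx, hy]
    · simp [resetClocks, hx, hy, Int.fract_nonneg]
    · simpa [resetClocks, hx, hy, nonpos] using h.fract_zero x
    · simpa [resetClocks, hx, hy] using h.fract_le x y

/-- Region equivalence is a time-abstract bisimulation. -/
theorem RegionEquiv.exists_delay [Finite C] {v v' : C → ℝ≥0} (h : A.RegionEquiv v v')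
    (d : ℝ≥0) : ∃ d', A.RegionEquiv (delayBy v d) (delayBy v' d') := by
  -- The marked points are 0, 1 and, for each clock, the delay after which it next becomes an
  -- integer. Their order is determined by the region. The points 0 and 1 force the matched `t` into
  -- [0, 1) and let it vanish exactly when the fractional part of `d` does.
  let g : (C → ℝ≥0) → Option (Option C) → ℝ := fun u i =>
    i.elim 0 fun j => j.elim 1 fun c => 1 - Int.fract (u c : ℝ)
  have hg : ∀ i j, g v i ≤ g v j ↔ g v' i ≤ g v' j := by
    have pos : ∀ r : ℝ, ¬ (1 ≤ Int.fract r) := fun r => (Int.fract_lt_one r).not_ge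
    have le : ∀ r : ℝ, Int.fract r ≤ 1 := fun r => (Int.fract_lt_one r).le
    have nonpos : ∀ r : ℝ, Int.fract r ≤ 0 ↔ Int.fract r = 0 := fun r =>
      ⟨fun k => le_antisymm k (Int.fract_nonneg r), fun k => k.le⟩
    rintro (_ | _ | x) (_ | _ | y) <;> simp [g, pos, le, nonpos, h.fract_zero]
    have e : ∀ a b : ℝ, 1 ≤ 1 - b + a ↔ b ≤ a := fun a b => by
      constructor <;> intro <;> linarith
    rw [e, e]
    exact h.fract_le y x
  obtain ⟨t, ht⟩ := exists_same_position hg (Int.fract (d : ℝ))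
  have ht0 : 0 ≤ t := (ht none).1.1 (Int.fract_nonneg _)
  have ht1 : t < 1 := by
    have := (ht (some none)).1
    simp only [g, Option.elim] at this
    rw [← not_le, ← this, not_le]
    exact Int.fract_lt_one _
  -- The same clocks carry into their integral part under both delays; together with `hge`, the same
  -- ones land exactly on the next integer.
  have hle : ∀ c, 1 ≤ Int.fract (v c : ℝ) + Int.fract (d : ℝ) ↔ 1 ≤ Int.fract (v' c : ℝ) + t := by
    intro c
    have := (ht (some (some c))).1
    simp only [g, Option.elim] at this
    rwa [tsub_le_iff_left, tsub_le_iff_left] at this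
  have hge : ∀ c, Int.fract (v c : ℝ) + Int.fract (d : ℝ) ≤ 1 ↔ Int.fract (v' c : ℝ) + t ≤ 1 := by
    intro c
    have := (ht (some (some c))).2
    simp only [g, Option.elim] at this
    rwa [le_sub_iff_add_le, le_sub_iff_add_le, add_comm, add_comm t] at this
  have hz : Int.fract (d : ℝ) = 0 ↔ t = 0 := by
    have := (ht none).2
    simp only [g, Option.elim] at this
    exact ⟨fun k => le_antisymm (this.1 k.le) ht0,
      fun k => le_antisymm (this.2 k.le) (Int.fract_nonneg _)⟩
  have hd : 0 ≤ ⌊(d : ℝ)⌋ := Int.floor_nonneg.2 d.2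
  have hd' : (0 : ℝ) ≤ ⌊(d : ℝ)⌋ := by exact_mod_cast hd
  -- the integral and fractional part after a delay by `n + t`
  have parts : ∀ (r : ℝ) (n : ℤ) (t : ℝ), 0 ≤ t → t < 1 →
      (1 ≤ Int.fract r + t → ⌊r + (n + t)⌋ = ⌊r⌋ + n + 1 ∧
        Int.fract (r + (n + t)) = Int.fract r + t - 1) ∧
      (Int.fract r + t < 1 → ⌊r + (n + t)⌋ = ⌊r⌋ + n ∧
        Int.fract (r + (n + t)) = Int.fract r + t) := by
    intro r n t h0 h1
    have r0 := Int.fract_nonneg r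
    have r1 := Int.fract_lt_one r
    have rf := Int.floor_add_fract r
    constructor <;> intro k
    · have : ⌊r + (n + t)⌋ = ⌊r⌋ + n + 1 := by
        rw [Int.floor_eq_iff]; push_cast; constructor <;> linarith
      refine ⟨this, ?_⟩
      rw [Int.fract, this]; push_cast; linarith
    · have : ⌊r + (n + t)⌋ = ⌊r⌋ + n := by
        rw [Int.floor_eq_iff]; push_cast; constructor <;> linarith
      refine ⟨this, ?_⟩
      rw [Int.fract, this]; push_cast; linarith
  refine ⟨⟨⌊(d : ℝ)⌋ + t, add_nonneg hd' ht0⟩, ?_⟩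
  have e1 : ∀ x, ((delayBy v d x : ℝ≥0) : ℝ) = v x + (⌊(d : ℝ)⌋ + Int.fract (d : ℝ)) := by
    intro x; simp [delayBy]
  have e2 : ∀ x, ((delayBy v' ⟨⌊(d : ℝ)⌋ + t, add_nonneg hd' ht0⟩ x : ℝ≥0) : ℝ)
      = v' x + (⌊(d : ℝ)⌋ + t) := by
    intro x; rfl
  have p1 := fun x => parts (v x) ⌊(d : ℝ)⌋ (Int.fract (d : ℝ)) (Int.fract_nonneg _)
    (Int.fract_lt_one _)
  have p2 := fun x => parts (v' x) ⌊(d : ℝ)⌋ t ht0 ht1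
  refine ⟨fun x => ?_, fun x => ?_, fun x y => ?_⟩
  · rw [e1, e2]
    rcases h.floor x with e | ⟨e, e'⟩
    · left
      by_cases k : 1 ≤ Int.fract (v x : ℝ) + Int.fract (d : ℝ)
      · rw [((p1 x).1 k).1, ((p2 x).1 ((hle x).1 k)).1, e]
      · rw [((p1 x).2 (not_le.1 k)).1, ((p2 x).2 (not_le.1 (mt (hle x).2 k))).1, e]
    · right
      constructor
      · linarith [Int.fract_nonneg (d : ℝ)]
      · linarith
  · rw [e1, e2]
    by_cases k : 1 ≤ Int.fract (v x : ℝ) + Int.fract (d : ℝ)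
    · rw [((p1 x).1 k).2, ((p2 x).1 ((hle x).1 k)).2, sub_eq_zero, sub_eq_zero]
      have k' := (hle x).1 k
      exact ⟨fun i => le_antisymm ((hge x).1 i.le) k', fun i => le_antisymm ((hge x).2 i.le) k⟩
    · rw [((p1 x).2 (not_le.1 k)).2, ((p2 x).2 (not_le.1 (mt (hle x).2 k))).2,
        add_eq_zero_iff_of_nonneg (Int.fract_nonneg _) (Int.fract_nonneg _),
        add_eq_zero_iff_of_nonneg (Int.fract_nonneg _) ht0, h.fract_zero, hz]
  · rw [e1, e2, e1, e2]
    have hxy := h.fract_le x y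
    have b1 := Int.fract_lt_one (v x : ℝ)
    have b2 := Int.fract_lt_one (v y : ℝ)
    have b3 := Int.fract_lt_one (v' x : ℝ)
    have b4 := Int.fract_lt_one (v' y : ℝ)
    have c1 := Int.fract_nonneg (v x : ℝ)
    have c2 := Int.fract_nonneg (v y : ℝ)
    have c3 := Int.fract_nonneg (v' x : ℝ)
    have c4 := Int.fract_nonneg (v' y : ℝ)
    -- If both clocks carry or neither does, their fractional parts are shifted equally and keep
    -- their order. If exactly one carries, its fractional part becomes the strictly smaller one.
    by_cases k : 1 ≤ Int.fract (v x : ℝ) + Int.fract (d : ℝ) <;>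
    by_cases k' : 1 ≤ Int.fract (v y : ℝ) + Int.fract (d : ℝ)
    · rw [((p1 x).1 k).2, ((p2 x).1 ((hle x).1 k)).2, ((p1 y).1 k').2,
        ((p2 y).1 ((hle y).1 k')).2, sub_le_sub_iff_right, sub_le_sub_iff_right,
        add_le_add_iff_right, add_le_add_iff_right]
      exact hxy
    · rw [((p1 x).1 k).2, ((p2 x).1 ((hle x).1 k)).2, ((p1 y).2 (not_le.1 k')).2,
        ((p2 y).2 (not_le.1 (mt (hle y).2 k'))).2]
      exact iff_of_true (by linarith) (by linarith)
    · rw [((p1 x).2 (not_le.1 k)).2, ((p2 x).2 (not_le.1 (mt (hle x).2 k))).2,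
        ((p1 y).1 k').2, ((p2 y).1 ((hle y).1 k')).2]
      exact iff_of_false (by linarith) (by linarith)
    · rw [((p1 x).2 (not_le.1 k)).2, ((p2 x).2 (not_le.1 (mt (hle x).2 k))).2,
        ((p1 y).2 (not_le.1 k')).2, ((p2 y).2 (not_le.1 (mt (hle y).2 k'))).2,
        add_le_add_iff_right, add_le_add_iff_right]
      exact hxy

/-- Moves can be matched from every valuation in the same region. -/
theorem Move.exists_of_region_eq [Finite C] {s t : A.State} (m : A.Move s t) {v : C → ℝ≥0}
    (hv : A.region v = A.region s.val) (hs : (A.inv s.cell).Sat v) :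
    ∃ (v' : C → ℝ≥0) (ht : (A.inv t.cell).Sat v')
      (m' : A.Move ⟨s.cell, v, hs⟩ ⟨t.cell, v', ht⟩),
      A.region v' = A.region t.val ∧ m'.letter = m.letter := by
  have h : A.RegionEquiv s.val v := region_eq_iff.1 hv.symm
  cases m with
  | delay d hcell hval hinv =>
    obtain ⟨d', hd'⟩ := h.exists_delay d
    have hsat := hd'.sat_inv (hinv d le_rfl)
    refine ⟨delayBy v d', hcell ▸ hsat, .delay d' hcell rfl fun e he => ?_, ?_, rfl⟩
    -- Intermediate valuations of the two delays need not be matched: the invariant holds at both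
    -- ends of the new delay, hence in between.
    · exact ClockConstraint.sat_of_between hs hsat (fun c => by simp [delayBy])
        (fun c => by simpa [delayBy] using he)
    · rw [hval]; exact region_eq_iff.2 hd'.symm
  | up U hcell hval =>
    have h' := h.reset (A.exit s.cell)
    refine ⟨_, h'.sat_inv (hval ▸ t.sat), .up U hcell rfl, ?_, rfl⟩
    rw [hval]; exact region_eq_iff.2 h'.symm
  | down U hcell hval =>
    have h' := h.reset (A.exit s.cell)
    refine ⟨_, h'.sat_inv (hval ▸ t.sat), .down U hcell rfl, ?_, rfl⟩
    rw [hval]; exact region_eq_iff.2 h'.symm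

variable (A) in
-- A region is determined by the integral part of each clock not exceeding the maximal constant M (a
-- number in 0, …, M, with `none` for larger clocks) and by the truth values of the integrality
-- tests and comparisons of fractional parts.
theorem finite_region [Finite C] : Finite A.Region := by
  classical
  let code (v : C → ℝ≥0) : (C → Option (Fin (A.maxConst + 1))) × (C → Prop) × (C → C → Prop) :=
    (fun x => if h : (v x : ℝ) ≤ A.maxConst then
        some ⟨⌊(v x : ℝ)⌋₊, Nat.lt_succ_of_le (Nat.floor_le_of_le h)⟩ else none,
      fun x => Int.fract (v x : ℝ) = 0, fun x y => Int.fract (v x : ℝ) ≤ Int.fract (v y : ℝ))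
  have hcode : ∀ v v', code v = code v' → A.region v = A.region v' := by
    intro v v' e
    simp only [code, Prod.mk.injEq, funext_iff, eq_iff_iff] at e
    refine region_eq_iff.2 ⟨fun x => ?_, e.2.1, e.2.2⟩
    have := e.1 x
    split_ifs at this with h1 h2
    · left
      have := congrArg Fin.val (Option.some.inj this)
      simp only at this
      rw [← Int.natCast_floor_eq_floor (v x).coe_nonneg,
        ← Int.natCast_floor_eq_floor (v' x).coe_nonneg, this]
    · rename_i h2
      exact Or.inr ⟨not_le.1 h1, not_le.1 h2⟩
  refine Finite.of_injective (fun r : A.Region => code r.out) fun r r' e => ?_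
  exact (Quotient.out_eq (s := A.regionSetoid) r).symm.trans
    ((hcode _ _ e).trans (Quotient.out_eq (s := A.regionSetoid) r'))

variable (A) in
theorem finite_regionState [Finite C] : Finite A.RegionState := by
  have := A.finite_region
  let code : A.RegionState → L ⊕ L × A.Region
    | .start l _ => .inl l
    | .cell l r _ => .inr (l, r)
  refine Finite.of_injective code ?_
  rintro (⟨l, hl⟩ | ⟨l, r, hr⟩) (⟨l', hl'⟩ | ⟨l', r', hr'⟩) e <;> simp_all [code]

end Region

/-! ### Tracing paths by runs and runs by paths -/

theorem Move.mk_content {s t : A.State} (m : A.Move s t) :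
    IPoms.mk m.content.tip.toIpomset = m.letter.val := by
  cases m <;> rfl

/-- The inductive step common to both directions. -/
theorem Path.gluesTo_snoc {s t t' : A.State} (π : A.Path s t) (m : A.Move t t')
    {w : List (IPoms α)} (h : IPoms.GluesTo w (IPoms.mk π.content.tip.toIpomset)) :
    IPoms.GluesTo (w ++ [m.letter.val])
      (IPoms.mk (Path.snoc π m).content.tip.toIpomset) :=
  .snoc h ⟨_, _, _, rfl, m.mk_content, rfl⟩

section Runs

variable [Fintype L]

/-- Every path that starts with all clocks at zero in an initial cell is traced by a run. -/
theorem Path.exists_run {s t : A.State} (π : A.Path s t) (hl : s.cell ∈ A.init)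
    (hs : s.val = fun _ => 0) :
    ∃ x, RegionState.cell t.cell (A.region t.val) t.sat_of_region_eq ∈ A.regionAutomaton.eval x ∧
      IPoms.GluesTo (x.map Subtype.val) (IPoms.mk π.content.tip.toIpomset) := by
  induction π with
  | nil =>
    obtain ⟨l, v, hv⟩ := s
    obtain rfl : v = fun _ => 0 := hs
    -- The empty path corresponds to a word of length one: the entering transition reads the
    -- identity that is the untimed content of the empty path.
    refine ⟨[StTe.identity (A.ev l)], ?_, .single _⟩
    rw [NFA.eval_singleton, NFA.mem_stepSet]
    exact ⟨_, ⟨l, hl, rfl⟩, RegionStep.enter l hl _⟩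
  | @snoc t t' π m ih =>
    obtain ⟨x, hx, hg⟩ := ih
    refine ⟨x ++ [m.letter], ?_, ?_⟩
    · rw [NFA.eval_append_singleton, NFA.mem_stepSet]
      exact ⟨_, hx, RegionStep.move m _ _⟩
    · rw [StTe.map_val_concat]
      exact π.gluesTo_snoc m hg

/-- Every run of the region automaton lifts to a path. -/
theorem exists_path_of_run [Finite C] {x : List (StTe α)} {l : L} {r : A.Region}
    {hr : ∀ v, A.region v = r → (A.inv l).Sat v}
    (h : RegionState.cell l r hr ∈ A.regionAutomaton.eval x) :
    ∃ (s : A.State) (v : C → ℝ≥0) (hv : (A.inv l).Sat v) (π : A.Path s ⟨l, v, hv⟩),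
      s.cell ∈ A.init ∧ s.val = (fun _ => 0) ∧ A.region v = r ∧
      IPoms.GluesTo (x.map Subtype.val) (IPoms.mk π.content.tip.toIpomset) := by
  induction x using List.reverseRecOn generalizing l r with
  | nil =>
    obtain ⟨_, _, e⟩ := h
    cases e
  | append_singleton x a ih =>
    rw [NFA.eval_append_singleton, NFA.mem_stepSet] at h
    obtain ⟨p, hp, hstep⟩ := h
    change A.RegionStep p a _ at hstep
    cases hstep with
    | enter l hl hr =>
      -- No transition leads into the extra copy of an initial cell, so the entering transition can
      -- only be the first one.
      have : x = [] := by
        rcases List.eq_nil_or_concat' x with e | ⟨y, b, rfl⟩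
        · exact e
        · rw [NFA.eval_append_singleton, NFA.mem_stepSet] at hp
          obtain ⟨q, _, hq⟩ := hp
          change A.RegionStep q b _ at hq
          cases hq
      subst this
      exact ⟨⟨l, _, hr _ rfl⟩, _, hr _ rfl, .nil, hl, rfl, rfl, .single _⟩
    | @move s t m hs ht =>
      obtain ⟨s₀, v, hv, π, h1, h2, h3, h4⟩ := ih hp
      -- The lifted path ends in a valuation `v` that is only region equivalent to `s.val`, so `m`
      -- is replaced by a move from `v` with the same letter.
      obtain ⟨v', hv', m', h5, h6⟩ := m.exists_of_region_eq h3 hv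
      refine ⟨s₀, v', hv', π.snoc m', h1, h2, h5, ?_⟩
      rw [StTe.map_val_concat, ← h6]
      exact π.gluesTo_snoc m' h4

theorem exists_path_of_mem_accepts [Finite C] {x : List (StTe α)}
    (hx : x ∈ A.regionAutomaton.accepts) :
    ∃ (s t : A.State) (π : A.Path s t), s.cell ∈ A.init ∧ s.val = (fun _ => 0) ∧
      t.cell ∈ A.accept ∧
      IPoms.GluesTo (x.map Subtype.val) (IPoms.mk π.content.tip.toIpomset) := by
  obtain ⟨_, ⟨l, r, hr, rfl, hl⟩, h⟩ := hx
  obtain ⟨s, v, hv, π, h1, h2, -, h4⟩ := exists_path_of_run h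
  exact ⟨s, _, π, h1, h2, hl, h4⟩

end Runs

end HDTA

theorem mainTheorem3 {α : Type u} {C : Type v} {L : Type w} [Finite α] [Finite C] [Fintype L]
    (A : HDTA α C L) :
    Finite A.RegionState ∧
    (∀ x ∈ A.regionAutomaton.accepts, ∃! p, IPoms.GluesTo (x.map Subtype.val) p) ∧
    {p | ∃ x ∈ A.regionAutomaton.accepts, IPoms.GluesTo (x.map Subtype.val) p} =
      TIPoms.unt '' A.language := by
  refine ⟨A.finite_regionState, fun x hx => ?_, Set.Subset.antisymm ?_ ?_⟩
  · obtain ⟨s, t, π, -, -, -, h⟩ := HDTA.exists_path_of_mem_accepts hx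
    exact ⟨_, h, fun q hq => hq.unique h⟩
  · rintro p ⟨x, hx, hp⟩
    obtain ⟨s, t, π, hs, h0, ht, h⟩ := HDTA.exists_path_of_mem_accepts hx
    -- The word glues both to `p` and to the untimed content of the lifted path, so the two
    -- coincide.
    exact ⟨_, ⟨s, t, π, hs, h0, ht, rfl⟩, h.unique hp⟩
  · rintro _ ⟨_, ⟨s, t, π, hs, h0, ht, rfl⟩, rfl⟩
    obtain ⟨x, hx, h⟩ := π.exists_run hs h0
    exact ⟨x, ⟨_, ⟨_, _, _, rfl, ht⟩, hx⟩, h⟩
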